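/- Model. An instance of size $n$ is processed by $m=\lceil n^{1-\alpha}\rceil$ machines, where $0<\alpha<1$ is a constant. A machine word holds either one real coordinate of an input point or a natural number of size polynomial in $n$, i.e. of $O(\log n)$ bits. The input points are distributed evenly (at most $\lceil n/m\rceil$ points per machine) but otherwise arbitrarily among the machines. The computation runs in synchronous rounds; in each round every machine sends words to the other machines, and then computes its new memory contents from its old memory contents and the words it received. Local computation is unrestricted, except that coordinates are indivisible: they can be inspected and copied, but no new real numbers can be stored or sent. A (deterministic) MPC algorithm has local memory $\Theta(n^\alpha)$ if, for some constant $K>0$, every machine stores at most $K n^\alpha$ words at any time, and sends at most $K n^\alpha$ words and receives at most $K n^\alpha$ words in each round. Problem. Let $P\subset\mathbb{R}^d$ be a set of $n$ points, $\varepsilon\ge 0$ a real number and $\mathit{minPts}\ge 1$ an integer. A point $v\in P$ is a *core point* if $|\{q\in P:\|q-v\|_2\le\varepsilon\}|\ge \mathit{minPts}$, and a *non-core point* otherwise. Lemma (Core Point Identification). There is an absolute constant $C>0$ such that for all constants $d\ge 2$, $\mathit{minPts}\ge 1$ and $\alpha\in(\tfrac12,1)$ there is a deterministic MPC algorithm with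 local memory $\Theta(n^\alpha)$ per machine which, for all $n$ and $\varepsilon\ge 0$ and every set $P\subset\mathbb{R}^d$ of $n$ points, uses at most $C/\alpha$ rounds (i.e. $O(1/\alpha)$ rounds) and labels all points of $P$ as core or non-core: at the end each point of $P$ is stored, exactly once over all machines, together with its correct label. The memory constant $K$ and the exponent of the polynomial bound on the numbers depend only on $d$, $\mathit{minPts}$ and $\alpha$. -/

import Mathlib

namespace MPC

/-- A machine word: either a real coordinate of an input point, or a natural number
(machine ID, counter, label, ...), whose bit length is limited in `RespectsLimits`. -/
inductive Word where
  | coord (x : ℝ)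
  | num (k : ℕ)

/-- A deterministic algorithm on `m` machines for the massively parallel computation model.
The memory of a machine is a list of words.  In round `t`, machine `i` with memory `M` sends the
words `send t i M j` to machine `j`; then, from its memory and from the words `R j` that it
received from each machine `j`, it computes its new memory `update t i M R`.  Local computation is
not restricted, except that real coordinates are indivisible: they can be inspected and copied,
but no new real number can be created, so that a word never carries more than one coordinate. -/
structure Algorithm (m : ℕ) where
  /-- The number of rounds, fixed in advance. -/
  rounds : ℕ
  send : ℕ → Fin m → List Word → Fin m → List Word
  update : ℕ → Fin m → List Word → (Fin m → List Word) → List Word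
  send_coord : ∀ t i M j x, Word.coord x ∈ send t i M j → Word.coord x ∈ M
  update_coord : ∀ t i M R x, Word.coord x ∈ update t i M R →
    Word.coord x ∈ M ∨ ∃ j, Word.coord x ∈ R j

/-- The memory of every machine after `t` rounds, when started with the memories `init`. -/
def Algorithm.memory {m : ℕ} (A : Algorithm m) (init : Fin m → List Word) :
    ℕ → Fin m → List Word
  | 0 => init
  | t + 1 => fun i => A.update t i (A.memory init t i)
      (fun j => A.send t j (A.memory init t j) i)

/-- The words sent from machine `i` to machine `j` in round `t` (rounds are counted from `0`). -/
def Algorithm.message {m : ℕ} (A : Algorithm m) (init : Fin m → List Word)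
    (t : ℕ) (i j : Fin m) : List Word :=
  A.send t i (A.memory init t i) j

/-- In the execution started from `init`, every machine always stores at most `S` words, and in
each round sends at most `S` words and receives at most `S` words, in total; every number stored
or sent is at most `W`. -/
structure Algorithm.RespectsLimits {m : ℕ} (A : Algorithm m) (init : Fin m → List Word)
    (S : ℝ) (W : ℕ) : Prop where
  memory_le : ∀ t ≤ A.rounds, ∀ i, ((A.memory init t i).length : ℝ) ≤ S
  sent_le : ∀ t < A.rounds, ∀ i, ((∑ j, (A.message init t i j).length : ℕ) : ℝ) ≤ S
  received_le : ∀ t < A.rounds, ∀ j, ((∑ i, (A.message init t i j).length : ℕ) : ℝ) ≤ S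
  memory_num_le : ∀ t ≤ A.rounds, ∀ i k, Word.num k ∈ A.memory init t i → k ≤ W
  message_num_le : ∀ t < A.rounds, ∀ i j k, Word.num k ∈ A.message init t i j → k ≤ W

/-- The number `m = ⌈n / n ^ α⌉` of machines for inputs of size `n`. -/
noncomputable def machineCount (n : ℕ) (α : ℝ) : ℕ := ⌈(n : ℝ) ^ (1 - α)⌉₊

end MPC

namespace DBSCAN

open MPC

/-- `v` is a core point of `P`: the closed ball of radius `ε` centred at `v` covers at least
`minPts` points of `P` (including `v`). -/
def IsCore {d : ℕ} (P : Finset (EuclideanSpace ℝ (Fin d))) (ε : ℝ) (minPts : ℕ)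
    (v : EuclideanSpace ℝ (Fin d)) : Prop :=
  v ∈ P ∧ minPts ≤ ((P : Set (EuclideanSpace ℝ (Fin d))) ∩ Metric.closedBall v ε).ncard

/-- The points of `P` are evenly distributed among `m` machines, in an arbitrary way and order:
each point lies on exactly one machine, and each machine holds at most `⌈|P| / m⌉` points. -/
def IsEvenDistribution {d m : ℕ} (P : Finset (EuclideanSpace ℝ (Fin d)))
    (input : Fin m → List (EuclideanSpace ℝ (Fin d))) : Prop :=
  (∑ i, (input i : Multiset (EuclideanSpace ℝ (Fin d)))) = P.val ∧
    ∀ i, (input i).length ≤ ⌈(P.card : ℝ) / m⌉₊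

/-- A point is stored in `d` words, one for each coordinate. -/
def encodePoint {d : ℕ} (p : EuclideanSpace ℝ (Fin d)) : List Word :=
  List.ofFn fun j => Word.coord (p j)

/-- A labelled point is stored in `d + 1` words: the point, then `1` for core or `0` for
non-core. -/
def encodeLabelled {d : ℕ} (q : EuclideanSpace ℝ (Fin d) × Bool) : List Word :=
  encodePoint q.1 ++ [Word.num (if q.2 then 1 else 0)]

/-- The initial memories: each machine stores the points that it was given. -/
def initialMemory {d m : ℕ} (input : Fin m → List (EuclideanSpace ℝ (Fin d))) :
    Fin m → List Word :=
  fun i => (input i).flatMap encodePoint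

/-- The memories `final` hold a correct core / non-core labelling of `P`: each machine holds a
list of labelled points, each point of `P` occurs exactly once over all machines (and no other
point occurs), and a point is labelled core if and only if it is a core point. -/
def IsCoreLabelling {d m : ℕ} (P : Finset (EuclideanSpace ℝ (Fin d))) (ε : ℝ) (minPts : ℕ)
    (final : Fin m → List Word) : Prop :=
  ∃ out : Fin m → List (EuclideanSpace ℝ (Fin d) × Bool),
    (∀ i, final i = (out i).flatMap encodeLabelled) ∧
    (∑ i, (((out i).map Prod.fst : List (EuclideanSpace ℝ (Fin d))) :
      Multiset (EuclideanSpace ℝ (Fin d)))) = P.val ∧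
    ∀ i, ∀ q ∈ out i, (q.2 = true ↔ IsCore P ε minPts q.1)

end DBSCAN

/-! Lay a grid of side `ε / d`. Points of one cell are within `ε` of each other, and all points
within `ε` of `p` lie in the `c = (2d+1)^d` cells around the cell of `p`. A cell with at least
`minPts` points therefore consists of core points, and `minPts` of its points suffice to reveal
this. A sparser cell has so few points that each of them can be shown to every machine holding a
point in a neighbouring cell; these machines report how many of their points are within `ε`, and the
total decides. All this passes through an owner machine of the cell.

The difficulty is to choose owners with balanced load. An item is a request of a machine for a cell
near one of its points; a machine has at most `L = c * ⌈n^α⌉` of them. Repetitions within a machine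
are removed, so one cell occurs in at most `m` items, and `m ≤ ⌈n^α⌉` because `α > 1/2`. Hence the
linearly ordered cells can be cut into about `m` intervals with `O(L)` items each. The cuts come
from a two-level deterministic sample sort with `g = ⌊√m⌋`: regular samples of samples yield fewer
than `g` coarse splitters, and the items between two of these are dealt to `g` machines, which find
fewer than `g` fine splitters in the same way. The number of rounds is 13, whatever `α` is.

Cells are never sent as such: an item is an input point with the number of an offset, so no new real
number arises. The loads rest on `cnt_le_cnt_sample`, `sum_cnt_coarse_le` and `length_recv_msg8_le`,
the labels on `snd_eq_of_mem_msg12` and `snd_eq_true_iff_of_mem_out`; `exists_algorithm_of_local`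
turns the message schedule into an `Algorithm`. -/

namespace MPC

/-! ### From local message schedules to algorithms. -/

section Realization

variable {m : ℕ} {ι : Type*}

/-- The memory contents in a full-information protocol: all messages received so far, each
preceded by its length, followed by the input. -/
def history (inp : ι → Fin m → List Word) (msg : ι → ℕ → Fin m → Fin m → List Word) (I : ι) :
    ℕ → Fin m → List Word
  | 0, i => inp I i
  | t + 1, i => ((List.finRange m).flatMap fun j =>
      Word.num (msg I t j i).length :: msg I t j i) ++ history inp msg I t i

/-- The length markers make the concatenation uniquely decodable; without them the boundaries
between messages of different senders would be lost. -/
theorem flatMap_length_cons_append_inj {β : Type*} (J : List β) (f f' : β → List Word)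
    (a a' : List Word)
    (h : (J.flatMap fun j => Word.num (f j).length :: f j) ++ a =
      (J.flatMap fun j => Word.num (f' j).length :: f' j) ++ a') :
    (∀ j ∈ J, f j = f' j) ∧ a = a' := by
  induction J with
  | nil => simpa using h
  | cons b J ih =>
    simp only [List.flatMap_cons, List.cons_append, List.append_assoc, List.cons.injEq,
      Word.num.injEq] at h
    obtain ⟨h1, h2⟩ := List.append_inj h.2 h.1
    obtain ⟨h3, h4⟩ := ih h2
    refine ⟨?_, h4⟩
    simpa [h1] using h3

theorem history_inj (inp : ι → Fin m → List Word) (msg : ι → ℕ → Fin m → Fin m → List Word)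
    (I I' : ι) (t : ℕ) (i : Fin m) (h : history inp msg I t i = history inp msg I' t i) :
    inp I i = inp I' i ∧ ∀ s < t, ∀ j, msg I s j i = msg I' s j i := by
  induction t with
  | zero => exact ⟨h, by simp⟩
  | succ t ih =>
    obtain ⟨h1, h2⟩ := flatMap_length_cons_append_inj _ _ _ _ _ h
    refine ⟨(ih h2).1, fun s hs j => ?_⟩
    rcases Nat.lt_succ_iff_lt_or_eq.1 hs with hs | rfl
    · exact (ih h2).2 s hs j
    · exact h1 j (List.mem_finRange j)

theorem coord_mem_history (inp : ι → Fin m → List Word)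
    (msg : ι → ℕ → Fin m → Fin m → List Word) (I : ι) (t : ℕ) (i : Fin m) (x : ℝ) :
    Word.coord x ∈ history inp msg I t i ↔
      Word.coord x ∈ inp I i ∨ ∃ s < t, ∃ j, Word.coord x ∈ msg I s j i := by
  induction t with
  | zero => simp [history]
  | succ t ih =>
    simp only [history, List.mem_append, List.mem_flatMap, List.mem_finRange, true_and,
      List.mem_cons, reduceCtorEq, false_or, ih, Nat.lt_succ_iff_lt_or_eq]
    constructor
    · rintro (⟨j, h⟩ | h | ⟨s, hs, h⟩)
      · exact Or.inr ⟨t, Or.inr rfl, j, h⟩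
      · exact Or.inl h
      · exact Or.inr ⟨s, Or.inl hs, h⟩
    · rintro (h | ⟨s, hs | rfl, h⟩)
      · exact Or.inr (Or.inl h)
      · exact Or.inr (Or.inr ⟨s, hs, h⟩)
      · exact Or.inl h

theorem length_history (inp : ι → Fin m → List Word)
    (msg : ι → ℕ → Fin m → Fin m → List Word) (I : ι) (t : ℕ) (i : Fin m) :
    (history inp msg I t i).length =
      (inp I i).length + ∑ s ∈ Finset.range t, ((∑ j, (msg I s j i).length) + m) := by
  induction t with
  | zero => simp [history]
  | succ t ih =>
    rw [Finset.sum_range_succ, history, List.length_append, ih, List.length_flatMap,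
      ← List.ofFn_eq_map, List.sum_ofFn]
    simp only [List.length_cons, Finset.sum_add_distrib, Finset.sum_const, Finset.card_univ,
      Fintype.card_fin, smul_eq_mul, mul_one]
    omega

theorem num_mem_history (inp : ι → Fin m → List Word)
    (msg : ι → ℕ → Fin m → Fin m → List Word) (I : ι) (t : ℕ) (i : Fin m) (k : ℕ)
    (hk : Word.num k ∈ history inp msg I t i) :
    Word.num k ∈ inp I i ∨ ∃ s < t, ∃ j, Word.num k ∈ msg I s j i ∨ k = (msg I s j i).length := by
  induction t with
  | zero => exact Or.inl hk
  | succ t ih =>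
    simp only [history, List.mem_append, List.mem_flatMap, List.mem_finRange, true_and,
      List.mem_cons, Word.num.injEq] at hk
    rcases hk with ⟨j, h | h⟩ | h
    · exact Or.inr ⟨t, Nat.lt_succ_self t, j, Or.inr h⟩
    · exact Or.inr ⟨t, Nat.lt_succ_self t, j, Or.inl h⟩
    · rcases ih h with h | ⟨s, hs, h⟩
      · exact Or.inl h
      · exact Or.inr ⟨s, hs.trans (Nat.lt_succ_self t), h⟩

open Classical in
/-- The words of `l` that may be written by a machine that knows the coordinates in `K`. -/
noncomputable def restrictCoords (K : ℝ → Prop) (l : List Word) : List Word :=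
  l.filter fun w => decide (∀ x, w = Word.coord x → K x)

theorem coord_mem_restrictCoords {K : ℝ → Prop} {l : List Word} {x : ℝ}
    (h : Word.coord x ∈ restrictCoords K l) : K x := by
  simp only [restrictCoords, List.mem_filter, decide_eq_true_eq] at h
  exact h.2 x rfl

theorem restrictCoords_eq_self {K : ℝ → Prop} {l : List Word}
    (h : ∀ x, Word.coord x ∈ l → K x) : restrictCoords K l = l := by
  rw [restrictCoords, List.filter_eq_self]
  intro w hw
  simp only [decide_eq_true_eq]
  rintro x rfl
  exact h x hw

open Classical in
/-- Messages and outputs that depend only on the information available to the machine that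
produces them are those of an algorithm. -/
theorem exists_algorithm_of_local (T : ℕ) (hT : 0 < T) (inp : ι → Fin m → List Word)
    (msg : ι → ℕ → Fin m → Fin m → List Word) (out : ι → Fin m → List Word)
    (hmsg : ∀ I I' t i, inp I i = inp I' i →
      (∀ s < t, ∀ j, msg I s j i = msg I' s j i) → ∀ j, msg I t i j = msg I' t i j)
    (hout : ∀ I I' i, inp I i = inp I' i →
      (∀ s < T, ∀ j, msg I s j i = msg I' s j i) → out I i = out I' i)
    (hcmsg : ∀ I t i j x, Word.coord x ∈ msg I t i j →
      Word.coord x ∈ inp I i ∨ ∃ s < t, ∃ k, Word.coord x ∈ msg I s k i)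
    (hcout : ∀ I i x, Word.coord x ∈ out I i →
      Word.coord x ∈ inp I i ∨ ∃ s < T, ∃ k, Word.coord x ∈ msg I s k i) :
    ∃ A : Algorithm m, A.rounds = T ∧ ∀ I, A.memory (inp I) T = out I ∧
      (∀ t < T, A.memory (inp I) t = history inp msg I t) ∧
      ∀ t < T, A.message (inp I) t = msg I t := by
  let mem : ι → ℕ → Fin m → List Word := fun I t i =>
    if t = T then out I i else history inp msg I t i
  -- The machine may choose any instance that explains its memory, because by `hmsg` all of them
  -- yield the same message. The filter makes `send_coord` immediate and leaves the genuine messages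
  -- unchanged by `hcmsg`.
  let snd : ℕ → Fin m → List Word → Fin m → List Word := fun t i M j =>
    restrictCoords (fun x => Word.coord x ∈ M)
      (if h : ∃ I, history inp msg I t i = M then msg h.choose t i j else [])
  let upd : ℕ → Fin m → List Word → (Fin m → List Word) → List Word := fun t i M R =>
    restrictCoords (fun x => Word.coord x ∈ M ∨ ∃ j, Word.coord x ∈ R j)
      (if h : ∃ I, history inp msg I t i = M ∧ ∀ j, msg I t j i = R j then
        mem h.choose (t + 1) i else [])
  let A : Algorithm m :=
    { rounds := T
      send := snd
      update := upd
      send_coord := fun t i M j x h => coord_mem_restrictCoords h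
      update_coord := fun t i M R x h =>
        coord_mem_restrictCoords (K := fun x => Word.coord x ∈ M ∨ ∃ j, Word.coord x ∈ R j) h }
  have hsnd : ∀ I t i j, snd t i (history inp msg I t i) j = msg I t i j := by
    intro I t i j
    have h : ∃ I', history inp msg I' t i = history inp msg I t i := ⟨I, rfl⟩
    have h2 := history_inj inp msg _ _ _ _ h.choose_spec
    simp only [snd, dif_pos h]
    rw [hmsg _ _ _ _ h2.1 h2.2]
    refine restrictCoords_eq_self fun x hx => ?_
    rw [coord_mem_history]
    exact hcmsg _ _ _ _ _ hx
  have hupd : ∀ I t i, t < T →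
      upd t i (history inp msg I t i) (fun j => msg I t j i) = mem I (t + 1) i := by
    intro I t i ht
    have h : ∃ I', history inp msg I' t i = history inp msg I t i ∧
      ∀ j, msg I' t j i = msg I t j i := ⟨I, rfl, fun _ => rfl⟩
    obtain ⟨h1, h3⟩ := h.choose_spec
    have h2 := history_inj inp msg _ _ _ _ h1
    have h4 : mem h.choose (t + 1) i = mem I (t + 1) i := by
      simp only [mem]
      split_ifs with hh
      · refine hout _ _ _ h2.1 fun s hs j => ?_
        rcases Nat.lt_succ_iff_lt_or_eq.1 (hh ▸ hs : s < t + 1) with hs | rfl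
        · exact h2.2 s hs j
        · exact h3 j
      · simp only [history, h1, h3]
    simp only [upd, dif_pos h, h4]
    refine restrictCoords_eq_self fun x hx => ?_
    have h5 : Word.coord x ∈ inp I i ∨ ∃ s < t + 1, ∃ k, Word.coord x ∈ msg I s k i := by
      simp only [mem] at hx
      split_ifs at hx with hh
      · have := hcout _ _ _ hx
        rwa [← hh] at this
      · exact (coord_mem_history inp msg I (t + 1) i x).1 hx
    rw [coord_mem_history]
    rcases h5 with h5 | ⟨s, hs, k, h5⟩
    · exact Or.inl (Or.inl h5)
    · rcases Nat.lt_succ_iff_lt_or_eq.1 hs with hs | rfl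
      · exact Or.inl (Or.inr ⟨s, hs, k, h5⟩)
      · exact Or.inr ⟨k, h5⟩
  have hmem : ∀ I t, t ≤ T → A.memory (inp I) t = mem I t := by
    intro I t
    induction t with
    | zero => intro _; funext i; simp [Algorithm.memory, mem, history, hT.ne]
    | succ t ih =>
      intro ht
      funext i
      have e : mem I t = history inp msg I t := by
        funext i
        simp [mem, (Nat.lt_of_succ_le ht).ne]
      simp only [Algorithm.memory, ih (Nat.le_of_succ_le ht), e]
      rw [← hupd I t i ht]
      show upd t i _ (fun j => snd t j _ i) = _
      simp only [hsnd]
  have hmem' : ∀ I, ∀ t < T, A.memory (inp I) t = history inp msg I t := by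
    intro I t ht
    rw [hmem I t ht.le]
    funext i
    simp [mem, ht.ne]
  refine ⟨A, rfl, fun I => ⟨?_, hmem' I, fun t ht => ?_⟩⟩
  · rw [hmem I T le_rfl]; funext i; simp [mem]
  · funext i j
    simp only [Algorithm.message, hmem' I t ht]
    exact hsnd I t i j

end Realization

end MPC

namespace MPC

/-! ### Counting, truncating, sampling and dealing lists. -/

section Lists

variable {X Y κ : Type*}

open Classical in
/-- The number of entries of `l` that satisfy `p`. -/
noncomputable def cnt (p : X → Prop) (l : List X) : ℕ := l.countP fun x => decide (p x)

open Classical in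
/-- The entries of `l` that satisfy `p`. -/
noncomputable def sel (p : X → Prop) (l : List X) : List X := l.filter fun x => decide (p x)

@[simp] theorem cnt_nil (p : X → Prop) : cnt p [] = 0 := rfl

open Classical in
theorem cnt_cons (p : X → Prop) (x : X) (l : List X) :
    cnt p (x :: l) = cnt p l + if p x then 1 else 0 := by
  simp [cnt, List.countP_cons]

theorem cnt_append (p : X → Prop) (l l' : List X) : cnt p (l ++ l') = cnt p l + cnt p l' :=
  List.countP_append

theorem cnt_perm (p : X → Prop) {l l' : List X} (h : l.Perm l') : cnt p l = cnt p l' :=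
  h.countP_eq _

theorem cnt_le_length (p : X → Prop) (l : List X) : cnt p l ≤ l.length := List.countP_le_length

theorem cnt_le_of_sublist (p : X → Prop) {l l' : List X} (h : l.Sublist l') : cnt p l ≤ cnt p l' :=
  h.countP_le

theorem cnt_mono {p q : X → Prop} {l : List X} (h : ∀ x ∈ l, p x → q x) : cnt p l ≤ cnt q l :=
  List.countP_mono_left fun x hx => by simpa using h x hx

theorem cnt_congr {p q : X → Prop} {l : List X} (h : ∀ x ∈ l, p x ↔ q x) : cnt p l = cnt q l :=
  le_antisymm (cnt_mono fun x hx => (h x hx).1) (cnt_mono fun x hx => (h x hx).2)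

theorem cnt_eq_zero {p : X → Prop} {l : List X} : cnt p l = 0 ↔ ∀ x ∈ l, ¬ p x := by
  simp [cnt]

theorem cnt_eq_length {p : X → Prop} {l : List X} : cnt p l = l.length ↔ ∀ x ∈ l, p x := by
  simp [cnt]

theorem cnt_pos {p : X → Prop} {l : List X} : 0 < cnt p l ↔ ∃ x ∈ l, p x := by
  simp [cnt]

theorem cnt_map (p : Y → Prop) (f : X → Y) (l : List X) :
    cnt p (l.map f) = cnt (fun x => p (f x)) l := by
  simp [cnt, List.countP_map, Function.comp_def]

@[simp] theorem mem_sel {p : X → Prop} {l : List X} {x : X} : x ∈ sel p l ↔ x ∈ l ∧ p x := by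
  simp [sel]

theorem length_sel (p : X → Prop) (l : List X) : (sel p l).length = cnt p l :=
  List.countP_eq_length_filter.symm

theorem cnt_sel (p q : X → Prop) (l : List X) : cnt p (sel q l) = cnt (fun x => p x ∧ q x) l := by
  rw [cnt, sel, List.countP_filter, cnt]
  exact List.countP_congr fun x _ => by simp

theorem sel_sublist (p : X → Prop) (l : List X) : (sel p l).Sublist l := List.filter_sublist

theorem cnt_true (l : List X) : cnt (fun _ => True) l = l.length := by simp [cnt]

theorem cnt_flatMap {m : ℕ} (p : X → Prop) (f : Fin m → List X) :
    cnt p ((List.finRange m).flatMap f) = ∑ j, cnt p (f j) := by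
  rw [cnt, List.countP_flatMap, ← List.ofFn_eq_map, List.sum_ofFn]
  rfl

theorem sum_cnt_fiber_le (m : ℕ) (f : X → ℕ) (p : X → Prop) (l : List X) :
    ∑ j : Fin m, cnt (fun x => p x ∧ f x = j) l ≤ cnt p l := by
  classical
  induction l with
  | nil => simp
  | cons x l ih =>
    simp only [cnt_cons, Finset.sum_add_distrib]
    refine Nat.add_le_add ih ?_
    by_cases hp : p x
    · simp only [hp, true_and, if_true, Finset.sum_boole, Nat.cast_id]
      refine Finset.card_le_one.2 fun a ha b hb => ?_
      simp only [Finset.mem_filter, Finset.mem_univ, true_and] at ha hb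
      exact Fin.ext (ha.symm.trans hb)
    · simp [hp]

theorem sum_length_sel_fiber_le (m : ℕ) (f : X → ℕ) (l : List X) :
    ∑ j : Fin m, (sel (fun x => f x = j) l).length ≤ l.length := by
  have := sum_cnt_fiber_le m f (fun _ => True) l
  simpa [length_sel, cnt_true] using this

/-- A list with at most `N` entries of each key, all of whose keys occur in `r`. -/
theorem length_le_mul_of_cnt_key_le (key : X → κ) (N : ℕ) (l r : List X)
    (hl : ∀ k, cnt (fun x => key x = k) l ≤ N) (hr : ∀ x ∈ l, ∃ y ∈ r, key y = key x) :
    l.length ≤ N * r.length := by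
  have h : cnt (fun x => ∃ y ∈ r, key y = key x) l ≤ N * r.length := by
    clear hr
    induction r with
    | nil => simp [cnt_eq_zero]
    | cons y r ih =>
      have : cnt (fun x => ∃ z ∈ y :: r, key z = key x) l ≤
          cnt (fun x => ∃ z ∈ r, key z = key x) l + cnt (fun x => key x = key y) l := by
        clear ih hl
        induction l with
        | nil => simp
        | cons x l ih =>
          simp only [cnt_cons, eq_comm (a := key x)] at ih ⊢
          split_ifs <;> simp_all <;> omega
      have h2 := hl (key y)
      rw [List.length_cons, mul_add, mul_one]
      omega
  rwa [cnt_eq_length.2 hr] at h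

section Trunc

open Classical in
/-- Keep at most `N` entries of each key. -/
noncomputable def trunc (key : X → κ) (N : ℕ) : List X → List X
  | [] => []
  | x :: l => if cnt (fun y => key y = key x) (trunc key N l) < N then x :: trunc key N l
      else trunc key N l

theorem trunc_sublist (key : X → κ) (N : ℕ) (l : List X) : (trunc key N l).Sublist l := by
  induction l with
  | nil => exact List.Sublist.refl _
  | cons x l ih =>
    rw [trunc]
    split_ifs
    · exact ih.cons_cons x
    · exact ih.cons x

theorem cnt_trunc (key : X → κ) (N : ℕ) (l : List X) (k : κ) :
    cnt (fun x => key x = k) (trunc key N l) = min N (cnt (fun x => key x = k) l) := by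
  classical
  induction l with
  | nil => simp [trunc]
  | cons x l ih =>
    rw [trunc, cnt_cons]
    by_cases hk : key x = k
    · subst hk
      rw [if_pos (rfl : key x = key x)]
      split_ifs with h
      · rw [cnt_cons, if_pos rfl]; omega
      · omega
    · split_ifs with h
      · simp [cnt_cons, hk, ih]
      · simp [ih]

end Trunc

section Sample

variable [LinearOrder κ]

/-- Cut the sorted list into blocks of length `t` and take the last entry of each. A block whose
last entry lies in `I` is charged to that entry. A block that meets `I` but ends outside it is the
last one to meet `I`, by convexity; this block, or the incomplete final one, accounts for the `+ 1`.
-/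
theorem exists_sample_of_pairwise (key : X → κ) (t : ℕ) (n : ℕ) (l : List X)
    (hn : l.length ≤ n) (hl : l.Pairwise fun x y => key x ≤ key y) (ht : 0 < t) :
    ∃ s : List X, s ⊆ l ∧ s.length * t ≤ l.length ∧
      ∀ I : Set κ, I.OrdConnected →
        cnt (fun x => key x ∈ I) l ≤ t * (cnt (fun x => key x ∈ I) s + 1) := by
  classical
  induction n generalizing l with
  | zero =>
    obtain rfl : l = [] := List.length_eq_zero_iff.1 (Nat.le_zero.1 hn)
    exact ⟨[], by simp⟩
  | succ n ih =>
    by_cases hlt : l.length < t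
    · exact ⟨[], by simp, by simp, fun I _ => (cnt_le_length _ _).trans (by simpa using hlt.le)⟩
    push Not at hlt
    have hab : l.take t ++ l.drop t = l := List.take_append_drop t l
    have hla : (l.take t).length = t := by simp [hlt]
    have hne : l.take t ≠ [] := by
      intro h; rw [h] at hla; simp at hla; omega
    obtain ⟨s, hs1, hs2, hs3⟩ := ih (l.drop t) (by rw [List.length_drop]; omega)
      (hl.sublist (List.drop_sublist t l))
    have hpw := hl
    rw [← hab, List.pairwise_append] at hpw
    obtain ⟨hpa, -, hpab⟩ := hpw
    set z := (l.take t).getLast hne with hz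
    have hzm : z ∈ l.take t := List.getLast_mem hne
    refine ⟨z :: s, ?_, ?_, fun I hI => ?_⟩
    · intro x hx
      rcases List.mem_cons.1 hx with rfl | hx
      · exact List.mem_of_mem_take hzm
      · exact List.mem_of_mem_drop (hs1 hx)
    · rw [List.length_drop] at hs2
      rw [List.length_cons, add_mul]
      omega
    · have h3 := hs3 I hI
      have ha : cnt (fun x => key x ∈ I) (l.take t) ≤ t := by
        simpa [hla] using cnt_le_length (fun x => key x ∈ I) (l.take t)
      have hsum : cnt (fun x => key x ∈ I) l =
          cnt (fun x => key x ∈ I) (l.take t) + cnt (fun x => key x ∈ I) (l.drop t) := by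
        rw [← cnt_append, hab]
      rw [hsum, cnt_cons]
      by_cases hzI : key z ∈ I
      · rw [if_pos hzI]
        nlinarith
      · rw [if_neg hzI, add_zero]
        rcases Nat.eq_zero_or_pos (cnt (fun x => key x ∈ I) (l.take t)) with h0 | h0
        · omega
        · obtain ⟨y, hy, hyI⟩ := cnt_pos.1 h0
          have hb : cnt (fun x => key x ∈ I) (l.drop t) = 0 := by
            rw [cnt_eq_zero]
            intro w hw hwI
            refine hzI (hI.out hyI hwI ⟨?_, hpab z hzm w hw⟩)
            rw [← List.dropLast_append_getLast hne, List.pairwise_append] at hpa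
            rw [← List.dropLast_append_getLast hne, List.mem_append] at hy
            rcases hy with hy | hy
            · exact hpa.2.2 y hy z (by simp [hz])
            · simp only [List.mem_singleton] at hy
              rw [hy]
          rw [hb, add_zero]
          exact ha.trans (Nat.le_mul_of_pos_right t (Nat.succ_pos _))

theorem exists_sample (key : X → κ) (t : ℕ) (l : List X) :
    ∃ s : List X, s ⊆ l ∧ s.length * t ≤ l.length ∧ (0 < t →
      ∀ I : Set κ, I.OrdConnected →
        cnt (fun x => key x ∈ I) l ≤ t * (cnt (fun x => key x ∈ I) s + 1)) := by
  rcases Nat.eq_zero_or_pos t with rfl | ht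
  · exact ⟨[], by simp⟩
  have hp := List.mergeSort_perm l (fun x y => decide (key x ≤ key y))
  have hs : (l.mergeSort fun x y => decide (key x ≤ key y)).Pairwise fun x y => key x ≤ key y := by
    have := List.pairwise_mergeSort (le := fun x y => decide (key x ≤ key y))
      (by simp only [decide_eq_true_eq]; intro a b c; exact le_trans)
      (by intro a b; simpa using le_total (key a) (key b)) l
    simpa using this
  obtain ⟨s, h1, h2, h3⟩ := exists_sample_of_pairwise key t _ _ le_rfl hs ht
  refine ⟨s, fun x hx => hp.mem_iff.1 (h1 hx), hp.length_eq ▸ h2, fun _ I hI => ?_⟩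
  rw [← cnt_perm _ hp]
  exact h3 I hI

/-- Every `t`-th entry of `l` in the order of the keys. -/
noncomputable def sample (key : X → κ) (t : ℕ) (l : List X) : List X :=
  (exists_sample key t l).choose

theorem sample_subset (key : X → κ) (t : ℕ) (l : List X) : sample key t l ⊆ l :=
  (exists_sample key t l).choose_spec.1

theorem length_sample_mul_le (key : X → κ) (t : ℕ) (l : List X) :
    (sample key t l).length * t ≤ l.length :=
  (exists_sample key t l).choose_spec.2.1

theorem cnt_le_cnt_sample (key : X → κ) {t : ℕ} (ht : 0 < t) (l : List X) {I : Set κ}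
    (hI : I.OrdConnected) :
    cnt (fun x => key x ∈ I) l ≤ t * (cnt (fun x => key x ∈ I) (sample key t l) + 1) :=
  (exists_sample key t l).choose_spec.2.2 ht I hI

theorem length_sample_le (key : X → κ) {t : ℕ} (ht : 0 < t) (l : List X) :
    (sample key t l).length ≤ l.length / t :=
  (Nat.le_div_iff_mul_le ht).2 (length_sample_mul_le key t l)

@[simp] theorem sample_nil (key : X → κ) (t : ℕ) : sample key t ([] : List X) = [] :=
  List.subset_nil.1 (sample_subset key t [])

/-- The number of entries of `F` whose key is at most `k`. -/
noncomputable def rank (key : X → κ) (F : List X) (k : κ) : ℕ := cnt (fun y => key y ≤ k) F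

theorem rank_mono (key : X → κ) (F : List X) : Monotone (rank key F) :=
  fun _ _ h => cnt_mono fun _ _ hx => le_trans hx h

theorem rank_lt_rank (key : X → κ) {F : List X} {k : κ} {y : X} (hy : y ∈ F) (h : k < key y) :
    rank key F k < rank key F (key y) := by
  classical
  obtain ⟨a, b, rfl⟩ := List.append_of_mem hy
  simp only [rank, cnt_append, cnt_cons, le_refl, if_true, not_le.2 h, if_false]
  have := rank_mono key a h.le
  have := rank_mono key b h.le
  simp only [rank] at *
  omega

/-- The keys of rank `v` that are not keys of entries of `F`. -/
def gap (key : X → κ) (F : List X) (v : ℕ) : Set κ :=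
  {k | rank key F k = v ∧ ∀ y ∈ F, key y ≠ k}

theorem ordConnected_gap (key : X → κ) (F : List X) (v : ℕ) : (gap key F v).OrdConnected := by
  refine ⟨fun a ha b hb k hk => ?_⟩
  have h1 := rank_mono key F hk.1
  have h2 := rank_mono key F hk.2
  rw [ha.1] at h1
  rw [hb.1] at h2
  refine ⟨le_antisymm h2 h1, fun y hy hyk => ?_⟩
  rcases hk.1.eq_or_lt with rfl | h
  · exact ha.2 y hy hyk
  · rw [← hyk] at h h2
    have := rank_lt_rank key hy h
    rw [ha.1] at this
    omega

/-- Distinct keys occurring in `F` have distinct ranks, so besides the gap only one key has rank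
`v`: the splitter at which this rank begins, if there is one. -/
theorem exists_mem_gap_or_eq [Nonempty κ] (key : X → κ) (F : List X) (v : ℕ) :
    ∃ k₀, ∀ k, rank key F k = v → k ∈ gap key F v ∨ k = k₀ := by
  by_cases h : ∃ y ∈ F, rank key F (key y) = v
  · obtain ⟨y, hy, hv⟩ := h
    refine ⟨key y, fun k hk => ?_⟩
    by_cases hF : ∃ z ∈ F, key z = k
    · right
      obtain ⟨z, hz, rfl⟩ := hF
      rcases lt_trichotomy (key z) (key y) with h | h | h
      · have := rank_lt_rank key hy h; omega
      · exact h
      · have := rank_lt_rank key hz h; omega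
    · push Not at hF
      exact Or.inl ⟨hk, hF⟩
  · push Not at h
    exact ⟨Classical.arbitrary κ, fun k hk => Or.inl ⟨hk, fun y hy e => h y hy (e ▸ hk)⟩⟩

theorem cnt_gap_self (key : X → κ) (F F' : List X) (hF : F' ⊆ F) (v : ℕ) :
    cnt (fun x => key x ∈ gap key F v) F' = 0 :=
  cnt_eq_zero.2 fun x hx h => h.2 x (hF hx) rfl

/-- Lists with distinct keys: a bound for the number of entries of rank `v`. -/
theorem sum_cnt_rank_le [Nonempty κ] {m : ℕ} (key : X → κ) (F : List X) (v : ℕ)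
    (A : Fin m → List X) (hA : ∀ i k, cnt (fun x => key x = k) (A i) ≤ 1) :
    ∑ i, cnt (fun x => rank key F (key x) = v) (A i) ≤
      (∑ i, cnt (fun x => key x ∈ gap key F v) (A i)) + m := by
  classical
  obtain ⟨k₀, hk₀⟩ := exists_mem_gap_or_eq key F v
  have h : ∀ i, cnt (fun x => rank key F (key x) = v) (A i) ≤
      cnt (fun x => key x ∈ gap key F v) (A i) + 1 := by
    intro i
    refine le_trans ?_ (Nat.add_le_add_left (hA i k₀) _)
    generalize A i = l
    induction l with
    | nil => simp
    | cons x l ih =>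
      simp only [cnt_cons]
      have := hk₀ (key x)
      split_ifs <;> simp_all <;> omega
  calc _ ≤ ∑ i, (cnt (fun x => key x ∈ gap key F v) (A i) + 1) := Finset.sum_le_sum fun i _ => h i
    _ = _ := by simp [Finset.sum_add_distrib]

end Sample

section Chunk

/-- The `k`-th of `g` consecutive blocks of `l`. -/
def chunk (g k : ℕ) (l : List X) : List X :=
  (l.drop (k * (l.length / g + 1))).take (l.length / g + 1)

theorem length_chunk_le (g k : ℕ) (l : List X) : (chunk g k l).length ≤ l.length / g + 1 := by
  simp [chunk]

theorem chunk_subset (g k : ℕ) (l : List X) : chunk g k l ⊆ l :=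
  fun _ hx => List.mem_of_mem_drop (List.mem_of_mem_take hx)

/-- Since `g * (l.length / g + 1)` exceeds the length, the blocks cover `l`, and the last ones may
be empty. They are disjoint, so each entry is dealt exactly once. -/
theorem sum_cnt_chunk {g : ℕ} (hg : 0 < g) (p : X → Prop) (l : List X) :
    ∑ k ∈ Finset.range g, cnt p (chunk g k l) = cnt p l := by
  have h : ∀ s n, ∑ k ∈ Finset.range n, cnt p ((l.drop (k * s)).take s) = cnt p (l.take (n * s)) := by
    intro s n
    induction n with
    | zero => simp
    | succ n ih => rw [Finset.sum_range_succ, ih, ← cnt_append, add_mul, one_mul, ← List.take_add]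
  have := h (l.length / g + 1) g
  rw [List.take_of_length_le] at this
  · exact this
  · have := Nat.lt_mul_div_succ l.length hg
    exact this.le

/-- Within one group of machines, `j % g` determines `j`. -/
theorem sum_fin_div_eq_sum_image {m g : ℕ} (b : ℕ) (f : ℕ → ℕ) :
    ∑ j : Fin m, (if (j : ℕ) / g = b then f (j % g) else 0) =
      ∑ k ∈ ((Finset.range m).filter fun j => j / g = b).image (· % g), f k := by
  rw [Fin.sum_univ_eq_sum_range (fun j => if j / g = b then f (j % g) else 0) m,
    ← Finset.sum_filter, Finset.sum_image]
  intro i hi j hj h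
  simp only [Finset.coe_filter, Finset.mem_range, Set.mem_ofPred_eq] at hi hj h
  rw [← Nat.div_add_mod i g, ← Nat.div_add_mod j g, h, hi.2, hj.2]

theorem sum_fin_div_eq_le {m g : ℕ} (hg : 0 < g) (b : ℕ) (f : ℕ → ℕ) :
    ∑ j : Fin m, (if (j : ℕ) / g = b then f (j % g) else 0) ≤ ∑ k ∈ Finset.range g, f k := by
  rw [sum_fin_div_eq_sum_image]
  refine Finset.sum_le_sum_of_subset fun k hk => ?_
  obtain ⟨j, -, rfl⟩ := Finset.mem_image.1 hk
  exact Finset.mem_range.2 (Nat.mod_lt _ hg)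

/-- Equality needs a complete group, with all remainders present; the last group may lack some. -/
theorem sum_fin_div_eq {m g : ℕ} (hg : 0 < g) (b : ℕ) (hm : (b + 1) * g ≤ m) (f : ℕ → ℕ) :
    ∑ j : Fin m, (if (j : ℕ) / g = b then f (j % g) else 0) = ∑ k ∈ Finset.range g, f k := by
  refine le_antisymm (sum_fin_div_eq_le hg b f) ?_
  rw [sum_fin_div_eq_sum_image]
  refine Finset.sum_le_sum_of_subset fun k hk => ?_
  have hk' := Finset.mem_range.1 hk
  refine Finset.mem_image.2 ⟨b * g + k, ?_, ?_⟩
  · rw [Finset.mem_filter, Finset.mem_range]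
    refine ⟨by rw [add_mul] at hm; omega, ?_⟩
    rw [mul_comm, Nat.mul_add_div hg, Nat.div_eq_of_lt hk', add_zero]
  · show (b * g + k) % g = k
    rw [mul_comm, Nat.mul_add_mod, Nat.mod_eq_of_lt hk']

end Chunk

end Lists

end MPC

/-! ### The protocol on the level of points. -/

namespace MPC

/-- The concatenation of the lists that machine `i` receives. -/
def recv {X : Type*} {m : ℕ} (M : Fin m → Fin m → List X) (i : Fin m) : List X :=
  (List.finRange m).flatMap fun j => M j i

/-- The parameters of the protocol: an item `(p, a)` with `a < c` names a key in the neighbourhood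
of `p`, the item `(p, c)` the key of `p` itself. -/
structure Protocol (E κ : Type*) where
  key : E × ℕ → κ
  c : ℕ
  minPts : ℕ
  g : ℕ
  L : ℕ
  near : E → E → Prop

namespace Protocol

variable {E κ : Type*} [LinearOrder κ] {m : ℕ} (Q : Protocol E κ)

/-- One item for each key in the neighbourhood of the points in `l`. -/
noncomputable def items (l : List E) : List (E × ℕ) :=
  trunc Q.key 1 (l.flatMap fun p => (List.range Q.c).map fun a => (p, a))

variable (I : Fin m → List E)

/-- Each machine sends a sample of its items to the coordinator of its group. -/
noncomputable def msg0 (i j : Fin m) : List (E × ℕ) :=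
  -- With groups of size `g + 2`, the bound `m ≤ g * (g + 2)` leaves at most `g` coordinators.
  if (i : ℕ) / (Q.g + 2) = j then sample Q.key Q.g (Q.items (I i)) else []

/-- The coordinators send a sample of what they received to the root. -/
noncomputable def msg1 (i j : Fin m) : List (E × ℕ) :=
  if (j : ℕ) = 0 then sample Q.key Q.g (recv (Q.msg0 I) i) else []

/-- The root chooses coarse splitters and sends one to each machine. -/
noncomputable def msg2 (i j : Fin m) : List (E × ℕ) :=
  -- The root receives at most `3 * L` items, so this step size leaves fewer than `g` splitters.
  -- Sending each of them to all machines would overload the root; hence each one goes to a machine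
  -- that broadcasts it in the next round.
  (sample Q.key (3 * Q.L / Q.g + 1) (recv (Q.msg1 I) i))[(j : ℕ)]?.toList

/-- The coarse splitters are broadcast. -/
noncomputable def msg3 (i _ : Fin m) : List (E × ℕ) := recv (Q.msg2 I) i

/-- The items between two coarse splitters are dealt to a group of machines. -/
noncomputable def msg4 (i j : Fin m) : List (E × ℕ) :=
  chunk Q.g (j % Q.g)
    (sel (fun x => rank Q.key (recv (Q.msg3 I) i) (Q.key x) = j / Q.g) (Q.items (I i)))

/-- Each machine sends a sample of what it received to the coordinator of its group. -/
noncomputable def msg5 (i j : Fin m) : List (E × ℕ) :=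
  if (i : ℕ) / Q.g = j then sample Q.key Q.g (recv (Q.msg4 I) i) else []

/-- Each coordinator chooses fine splitters and sends one to each machine in its group. -/
noncomputable def msg6 (i j : Fin m) : List (E × ℕ) :=
  if (j : ℕ) / Q.g = i then
    (sample Q.key (8 * Q.L / Q.g + 1) (recv (Q.msg5 I) i))[(j : ℕ) % Q.g]?.toList else []

/-- The fine splitters are broadcast. -/
noncomputable def msg7 (i _ : Fin m) : List (E × ℕ) := recv (Q.msg6 I) i

/-- All splitters, as known to machine `i`. -/
noncomputable def splitters (i : Fin m) : List (E × ℕ) := recv (Q.msg3 I) i ++ recv (Q.msg7 I) i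

/-- The index of the machine that is responsible for the key `k`, as computed by machine `i`. -/
noncomputable def owner (i : Fin m) (k : κ) : ℕ := rank Q.key (Q.splitters I i) k / 3

/-- Each machine announces its items to the owners of their keys. -/
noncomputable def msg8 (i j : Fin m) : List (E × ℕ) :=
  sel (fun x => Q.owner I i (Q.key x) = j) (Q.items (I i))

/-- Each machine sends at most `minPts` of its points of each key to the owner of the key. -/
noncomputable def msg9 (i j : Fin m) : List (E × ℕ) :=
  sel (fun x => Q.owner I i (Q.key x) = j) (trunc Q.key Q.minPts ((I i).map fun p => (p, Q.c)))

/-- The owners return at most `minPts` points of each announced key. -/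
noncomputable def msg10 (i j : Fin m) : List (E × ℕ) :=
  sel (fun x => ∃ y ∈ Q.msg8 I j i, Q.key y = Q.key x) (trunc Q.key Q.minPts (recv (Q.msg9 I) i))

/-- For each such point, the owner is told the number of points that are near to it. -/
noncomputable def msg11 (i j : Fin m) : List (E × ℕ) :=
  (Q.msg10 I j i).map fun q => (q.1, cnt (fun p => Q.near q.1 p) (I i))

/-- The owners add these numbers up and return the results. -/
noncomputable def msg12 (i j : Fin m) : List (E × ℕ) :=
  (Q.msg11 I j i).map fun q =>
    (q.1, ((sel (fun r => r.1 = q.1) (recv (Q.msg11 I) i)).map Prod.snd).sum)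

open Classical in
/-- The labels computed by machine `i`. -/
noncomputable def out (i : Fin m) : List (E × Bool) :=
  (I i).map fun p => (p, decide
    -- The first alternative detects a dense cell, the second uses the total computed for `p`
    -- itself. In a dense cell `p` may have been truncated away and have no total.
    (Q.minPts ≤ cnt (fun x => Q.key x = Q.key (p, Q.c)) (recv (Q.msg10 I) i) ∨
      ∃ r ∈ recv (Q.msg12 I) i, r.1 = p ∧ Q.minPts ≤ r.2))

/-- All messages of the protocol. -/
noncomputable def msg : ℕ → Fin m → Fin m → List (E × ℕ)
  | 0 => Q.msg0 I
  | 1 => Q.msg1 I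
  | 2 => Q.msg2 I
  | 3 => Q.msg3 I
  | 4 => Q.msg4 I
  | 5 => Q.msg5 I
  | 6 => Q.msg6 I
  | 7 => Q.msg7 I
  | 8 => Q.msg8 I
  | 9 => Q.msg9 I
  | 10 => Q.msg10 I
  | 11 => Q.msg11 I
  | 12 => Q.msg12 I
  | _ => fun _ _ => []

end Protocol

/-! ### Communication volume of the rounds. -/

section Recv

variable {X : Type*} {m : ℕ}

theorem mem_recv {M : Fin m → Fin m → List X} {i : Fin m} {x : X} :
    x ∈ recv M i ↔ ∃ j, x ∈ M j i := by
  simp [recv]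

theorem cnt_recv (p : X → Prop) (M : Fin m → Fin m → List X) (i : Fin m) :
    cnt p (recv M i) = ∑ j, cnt p (M j i) := cnt_flatMap p _

theorem length_recv (M : Fin m → Fin m → List X) (i : Fin m) :
    (recv M i).length = ∑ j, (M j i).length := by
  simpa [cnt_true] using cnt_recv (fun _ => True) M i

theorem recv_eq_nil {M : Fin m → Fin m → List X} {i : Fin m} :
    recv M i = [] ↔ ∀ j, M j i = [] := by
  simp [recv]

theorem length_toList_getElem?_le (l : List X) (k : ℕ) : (l[k]?.toList).length ≤ 1 := by
  cases l[k]? <;> simp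

theorem sum_length_toList_getElem?_le (l : List X) :
    ∑ k : Fin m, (l[(k : ℕ)]?.toList).length ≤ l.length := by
  rw [Fin.sum_univ_eq_sum_range (fun k => (l[k]?.toList).length) m]
  calc _ = ∑ k ∈ Finset.range m, if k < l.length then 1 else 0 := by
        refine Finset.sum_congr rfl fun k _ => ?_
        split_ifs with h
        · simp [h]
        · simp [List.getElem?_eq_none (not_lt.1 h)]
    _ ≤ ((Finset.range l.length)).card := by
        rw [← Finset.sum_filter, Finset.sum_const, smul_eq_mul, mul_one]
        refine Finset.card_le_card fun k hk => ?_
        simp only [Finset.mem_filter, Finset.mem_range] at hk ⊢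
        exact hk.2
    _ = l.length := Finset.card_range _

theorem sum_fin_group_le {q : ℕ} (hq : 0 < q) (b B : ℕ) (f : Fin m → ℕ) (hf : ∀ i, f i ≤ B) :
    ∑ i : Fin m, (if (i : ℕ) / q = b then f i else 0) ≤ q * B := by
  calc _ ≤ ∑ i : Fin m, (if (i : ℕ) / q = b then (fun _ => B) ((i : ℕ) % q) else 0) := by
        refine Finset.sum_le_sum fun i _ => ?_
        split_ifs
        · exact hf i
        · exact le_rfl
    _ ≤ _ := (sum_fin_div_eq_le hq b fun _ => B).trans (by simp)

theorem sum_fin_eq_le_one (k : ℕ) (f : Fin m → ℕ) (hf : ∀ i, f i ≤ 1) :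
    ∑ i : Fin m, (if k = (i : ℕ) then f i else 0) ≤ 1 := by
  have := sum_fin_group_le (q := 1) one_pos k 1 f hf
  simpa [eq_comm] using this

end Recv

namespace Protocol

variable {E κ : Type*} {m : ℕ} {Q : Protocol E κ}

/-- Machine number, group size and input size fit together. -/
structure Fits (Q : Protocol E κ) (m : ℕ) : Prop where
  g_pos : 0 < Q.g
  sq_le : Q.g * Q.g ≤ m
  le_mul : m ≤ Q.g * (Q.g + 2)
  m_le : m ≤ Q.L
  self : ∀ p, ∃ a < Q.c, Q.key (p, a) = Q.key (p, Q.c)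

theorem cnt_items_le (l : List E) (k : κ) : cnt (fun x => Q.key x = k) (Q.items l) ≤ 1 := by
  rw [items, cnt_trunc]; exact min_le_left _ _

theorem exists_mem_items {l : List E} {p : E} (hp : p ∈ l) {a : ℕ} (ha : a < Q.c) :
    ∃ x ∈ Q.items l, Q.key x = Q.key (p, a) := by
  have : 0 < cnt (fun x => Q.key x = Q.key (p, a)) (Q.items l) := by
    rw [items, cnt_trunc]
    refine lt_min one_pos (cnt_pos.2 ⟨(p, a), ?_, rfl⟩)
    simpa using ⟨hp, ha⟩
  exact cnt_pos.1 this

theorem length_items_le (l : List E) : (Q.items l).length ≤ l.length * Q.c := by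
  refine (trunc_sublist _ _ _).length_le.trans ?_
  simp [List.length_flatMap]

theorem fst_mem_of_mem_items {l : List E} {x : E × ℕ} (hx : x ∈ Q.items l) :
    x.1 ∈ l ∧ x.2 < Q.c := by
  have := (trunc_sublist _ _ _).subset hx
  simp only [List.mem_flatMap, List.mem_map, List.mem_range] at this
  obtain ⟨p, hp, a, ha, rfl⟩ := this
  exact ⟨hp, ha⟩

section Loads

variable (hQ : Q.Fits m) {I : Fin m → List E} (hI : ∀ i, (Q.items (I i)).length ≤ Q.L)
include hQ

theorem Fits.g_le : Q.g ≤ m := (Nat.le_mul_self _).trans hQ.sq_le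

theorem Fits.sq_le_L : Q.g * Q.g ≤ Q.L := hQ.sq_le.trans hQ.m_le

theorem Fits.g_le_L : Q.g ≤ Q.L := hQ.g_le.trans hQ.m_le

theorem Fits.m_pos : 0 < m := hQ.g_pos.trans_le hQ.g_le

theorem div_lt_g (i : Fin m) : (i : ℕ) / (Q.g + 2) < Q.g :=
  Nat.div_lt_of_lt_mul (i.2.trans_le (hQ.le_mul.trans (mul_comm _ _).le))

variable [LinearOrder κ]

theorem recv_msg0_eq_nil {j : Fin m} (hj : Q.g ≤ j) : recv (Q.msg0 I) j = [] := by
  refine recv_eq_nil.2 fun i => ?_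
  rw [msg0, if_neg]
  have := div_lt_g hQ i
  omega

include hI

theorem length_recv_msg0_le (j : Fin m) : (recv (Q.msg0 I) j).length ≤ 3 * Q.L := by
  rw [length_recv]
  simp only [msg0, apply_ite List.length, List.length_nil]
  refine (sum_fin_group_le (by omega) j (Q.L / Q.g) _ fun i =>
    (length_sample_le _ hQ.g_pos _).trans (Nat.div_le_div_right (hI i))).trans ?_
  have h1 := Nat.mul_div_le Q.L Q.g
  have h2 : (Q.g + 2) * (Q.L / Q.g) ≤ (3 * Q.g) * (Q.L / Q.g) :=
    Nat.mul_le_mul_right _ (by have := hQ.g_pos; omega)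
  rw [mul_assoc] at h2
  omega

theorem length_recv_msg1_le (j : Fin m) : (recv (Q.msg1 I) j).length ≤ 3 * Q.L := by
  have h : ∀ i : Fin m, (Q.msg1 I i j).length ≤ if (i : ℕ) / Q.g = 0 then 3 * Q.L / Q.g else 0 := by
    intro i
    split_ifs with h
    · rw [msg1]
      split_ifs
      · exact (length_sample_le _ hQ.g_pos _).trans
          (Nat.div_le_div_right (length_recv_msg0_le hQ hI i))
      · simp
    · have : Q.g ≤ i := by
        by_contra h'
        exact h (Nat.div_eq_of_lt (not_le.1 h'))
      rw [msg1, recv_msg0_eq_nil hQ this]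
      simp
  rw [length_recv]
  refine (Finset.sum_le_sum fun i _ => h i).trans ?_
  refine (sum_fin_group_le hQ.g_pos 0 (3 * Q.L / Q.g) (fun _ => 3 * Q.L / Q.g)
    fun _ => le_rfl).trans ?_
  exact Nat.mul_div_le _ _

omit hI in
theorem length_sample_lt_g (B : ℕ) (l : List (E × ℕ)) (hl : l.length ≤ B) :
    (sample Q.key (B / Q.g + 1) l).length < Q.g := by
  have h1 := (length_sample_mul_le Q.key (B / Q.g + 1) l).trans hl
  have h2 := Nat.lt_mul_div_succ B hQ.g_pos
  exact lt_of_mul_lt_mul_right (h1.trans_lt h2) (Nat.zero_le _)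

omit hI hQ in
theorem recv_msg1_eq_nil {j : Fin m} (hj : (j : ℕ) ≠ 0) : recv (Q.msg1 I) j = [] :=
  recv_eq_nil.2 fun i => by rw [msg1, if_neg hj]

omit hI hQ in
theorem length_recv_msg2_le (j : Fin m) : (recv (Q.msg2 I) j).length ≤ 1 := by
  rw [length_recv]
  refine le_trans (Finset.sum_le_sum fun i _ => ?_)
    (sum_fin_eq_le_one 0 (fun i => (Q.msg2 I i j).length) fun i => length_toList_getElem?_le _ _)
  split_ifs with h
  · exact le_rfl
  · rw [msg2, recv_msg1_eq_nil (Ne.symm h)]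
    simp

theorem length_recv_msg3_lt (j : Fin m) : (recv (Q.msg3 I) j).length < Q.g := by
  let r : Fin m := ⟨0, hQ.m_pos⟩
  refine lt_of_le_of_lt ?_ (length_sample_lt_g hQ _ _ (length_recv_msg1_le hQ hI r))
  rw [length_recv]
  refine le_trans (Finset.sum_le_sum fun k _ => ?_) (sum_length_toList_getElem?_le (m := m) _)
  rw [msg3, length_recv, Finset.sum_eq_single r]
  · rfl
  · intro i _ hi
    rw [msg2, recv_msg1_eq_nil fun h => hi (Fin.ext h)]
    simp
  · simp

theorem sample_subset_recv_msg3 (r j : Fin m) :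
    sample Q.key (3 * Q.L / Q.g + 1) (recv (Q.msg1 I) r) ⊆ recv (Q.msg3 I) j := by
  intro x hx
  obtain ⟨k, hk, rfl⟩ := List.getElem_of_mem hx
  have hkm := (hk.trans (length_sample_lt_g hQ _ _ (length_recv_msg1_le hQ hI r))).trans_le hQ.g_le
  refine mem_recv.2 ⟨⟨k, hkm⟩, mem_recv.2 ⟨r, ?_⟩⟩
  simp [msg2, hk]

/-- The number of items between two consecutive coarse splitters. -/
theorem sum_cnt_coarse_le [Nonempty κ] (j : Fin m) (v : ℕ) :
    ∑ i, cnt (fun x => rank Q.key (recv (Q.msg3 I) j) (Q.key x) = v) (Q.items (I i)) ≤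
      7 * (Q.g * Q.L) := by
  have hg := hQ.g_pos
  set F := recv (Q.msg3 I) j with hF
  set G := gap Q.key F v with hG
  have hGc : G.OrdConnected := ordConnected_gap _ _ _
  let r : Fin m := ⟨0, hQ.m_pos⟩
  have h1 : ∑ i, cnt (fun x => Q.key x ∈ G) (sample Q.key Q.g (Q.items (I i))) ≤
      ∑ a, cnt (fun x => Q.key x ∈ G) (recv (Q.msg0 I) a) := by
    simp only [cnt_recv]
    rw [Finset.sum_comm]
    refine Finset.sum_le_sum fun i _ => ?_
    have := Finset.single_le_sum (s := Finset.univ)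
      (f := fun a => cnt (fun x => Q.key x ∈ G) (Q.msg0 I i a)) (fun _ _ => Nat.zero_le _)
      (Finset.mem_univ ⟨_, (div_lt_g hQ i).trans_le hQ.g_le⟩)
    refine le_trans (le_of_eq ?_) this
    simp [msg0]
  have h2 : ∑ a, cnt (fun x => Q.key x ∈ G) (recv (Q.msg0 I) a) ≤
      Q.g * cnt (fun x => Q.key x ∈ G) (recv (Q.msg1 I) r) + Q.g * Q.g := by
    calc _ ≤ ∑ a : Fin m, (Q.g * cnt (fun x => Q.key x ∈ G) (Q.msg1 I a r) +
          if (a : ℕ) / Q.g = 0 then Q.g else 0) := by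
          refine Finset.sum_le_sum fun a _ => ?_
          split_ifs with h
          · have := cnt_le_cnt_sample Q.key hg (recv (Q.msg0 I) a) hGc
            rw [mul_add, mul_one] at this
            simpa [msg1, r] using this
          · have : Q.g ≤ a := by
              by_contra h'
              exact h (Nat.div_eq_of_lt (not_le.1 h'))
            rw [recv_msg0_eq_nil hQ this]
            simp
      _ ≤ _ := by
          rw [Finset.sum_add_distrib, ← Finset.mul_sum, cnt_recv]
          exact Nat.add_le_add_left (sum_fin_group_le hg 0 Q.g (fun _ => Q.g) fun _ => le_rfl) _
  -- All entries of the root's sample are splitters, so none lies in the gap and only the sampling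
  -- error remains.
  have h3 : cnt (fun x => Q.key x ∈ G) (recv (Q.msg1 I) r) ≤ 3 * Q.L / Q.g + 1 := by
    have := cnt_le_cnt_sample Q.key (Nat.succ_pos (3 * Q.L / Q.g)) (recv (Q.msg1 I) r) hGc
    rw [hG, cnt_gap_self _ _ _ (sample_subset_recv_msg3 hQ hI r j)] at this
    simpa using this
  have h4 : ∑ i, cnt (fun x => Q.key x ∈ G) (Q.items (I i)) ≤
      Q.g * (∑ i, cnt (fun x => Q.key x ∈ G) (sample Q.key Q.g (Q.items (I i))) + m) := by
    calc _ ≤ ∑ i, Q.g * (cnt (fun x => Q.key x ∈ G) (sample Q.key Q.g (Q.items (I i))) + 1) :=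
          Finset.sum_le_sum fun i _ => cnt_le_cnt_sample Q.key hg _ hGc
      _ = _ := by rw [← Finset.mul_sum, Finset.sum_add_distrib]; simp
  have h5 := sum_cnt_rank_le Q.key F v (fun i => Q.items (I i)) fun i k => cnt_items_le _ _
  rw [← hG] at h5
  -- The parts are `3 * L` and `g` from the root, `g * g` from the sampling errors of the
  -- coordinators and `m` from those of the machines, each of the last three being at most `L`. The
  -- seventh `g * L` of the result pays for the single splitter key of rank `v`.
  have h6 : ∑ i, cnt (fun x => Q.key x ∈ G) (sample Q.key Q.g (Q.items (I i))) + m ≤ 6 * Q.L := by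
    have e1 := Nat.mul_le_mul_left Q.g h3
    rw [mul_add, mul_one] at e1
    have e2 := Nat.mul_div_le (3 * Q.L) Q.g
    have := hQ.sq_le_L
    have := hQ.g_le_L
    have := hQ.m_le
    omega
  have h7 := Nat.mul_le_mul_left Q.g h6
  have h8 : m ≤ Q.g * Q.L := hQ.m_le.trans (Nat.le_mul_of_pos_left _ hg)
  have e : Q.g * (6 * Q.L) = 6 * (Q.g * Q.L) := by ring
  omega

theorem length_recv_msg4_le [Nonempty κ] (j : Fin m) : (recv (Q.msg4 I) j).length ≤ 8 * Q.L := by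
  have hg := hQ.g_pos
  have h := sum_cnt_coarse_le hQ hI j ((j : ℕ) / Q.g)
  rw [length_recv]
  have h1 : ∀ i, (Q.msg4 I i j).length ≤
      cnt (fun x => rank Q.key (recv (Q.msg3 I) j) (Q.key x) = (j : ℕ) / Q.g) (Q.items (I i)) / Q.g
        + 1 := by
    intro i
    refine (length_chunk_le _ _ _).trans ?_
    rw [length_sel]
    exact le_rfl
  refine (Finset.sum_le_sum fun i _ => h1 i).trans ?_
  rw [Finset.sum_add_distrib]
  simp only [Finset.sum_const, Finset.card_univ, Fintype.card_fin, smul_eq_mul, mul_one]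
  have h2 : Q.g * ∑ i, cnt (fun x => rank Q.key (recv (Q.msg3 I) j) (Q.key x) = (j : ℕ) / Q.g)
      (Q.items (I i)) / Q.g ≤ Q.g * (7 * Q.L) := by
    rw [Finset.mul_sum]
    refine (Finset.sum_le_sum fun i _ => Nat.mul_div_le _ _).trans (h.trans (le_of_eq (by ring)))
  have h3 := Nat.le_of_mul_le_mul_left h2 hg
  have := hQ.m_le
  omega

theorem length_recv_msg5_le [Nonempty κ] (j : Fin m) : (recv (Q.msg5 I) j).length ≤ 8 * Q.L := by
  rw [length_recv]
  simp only [msg5, apply_ite List.length, List.length_nil]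
  refine (sum_fin_group_le hQ.g_pos j (8 * Q.L / Q.g) _ fun i =>
    (length_sample_le _ hQ.g_pos _).trans
      (Nat.div_le_div_right (length_recv_msg4_le hQ hI i))).trans ?_
  exact Nat.mul_div_le _ _

omit hI hQ in
theorem length_recv_msg6_le (j : Fin m) : (recv (Q.msg6 I) j).length ≤ 1 := by
  rw [length_recv]
  simp only [msg6, apply_ite List.length, List.length_nil]
  exact sum_fin_eq_le_one _ _ fun i => length_toList_getElem?_le _ _

omit hI hQ in
theorem length_recv_msg7_le (j : Fin m) : (recv (Q.msg7 I) j).length ≤ m := by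
  rw [length_recv]
  refine (Finset.sum_le_sum fun i _ => length_recv_msg6_le i).trans ?_
  simp

theorem sample_subset_recv_msg7 [Nonempty κ] (b j : Fin m) (hb : (b : ℕ) < Q.g) :
    sample Q.key (8 * Q.L / Q.g + 1) (recv (Q.msg5 I) b) ⊆ recv (Q.msg7 I) j := by
  intro x hx
  obtain ⟨k, hk, rfl⟩ := List.getElem_of_mem hx
  have hkg := hk.trans (length_sample_lt_g hQ _ _ (length_recv_msg5_le hQ hI b))
  have h1 : (b : ℕ) * Q.g + k < m := by
    have := Nat.mul_le_mul_right Q.g hb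
    have := hQ.sq_le
    rw [Nat.succ_mul] at *
    omega
  have h2 : ((b : ℕ) * Q.g + k) / Q.g = b := by
    rw [mul_comm, Nat.mul_add_div hQ.g_pos, Nat.div_eq_of_lt hkg, add_zero]
  have h3 : ((b : ℕ) * Q.g + k) % Q.g = k := by
    rw [mul_comm, Nat.mul_add_mod, Nat.mod_eq_of_lt hkg]
  refine mem_recv.2 ⟨⟨_, h1⟩, mem_recv.2 ⟨b, ?_⟩⟩
  simp [msg6, h2, h3, hk]

theorem owner_lt (i : Fin m) (k : κ) : Q.owner I i k < m := by
  have h1 : rank Q.key (Q.splitters I i) k ≤ _ := cnt_le_length _ _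
  have h2 := length_recv_msg3_lt hQ hI i
  have h3 := length_recv_msg7_le (Q := Q) (I := I) i
  have h4 := hQ.g_le
  rw [splitters, List.length_append] at h1
  rw [owner, splitters]
  omega

/-- The gap lies within one coarse bucket, whose items were dealt to a single group. The
coordinator's sample misses the gap, so it holds at most `8 * L / g + 1` sampled items there;
multiplying by `g` and adding the error `g` of each of the `g` machines gives at most `10 * L`. -/
theorem sum_cnt_gap_splitters_le [Nonempty κ] (j : Fin m) (v : ℕ) :
    ∑ i, cnt (fun x => Q.key x ∈ gap Q.key (Q.splitters I j) v) (Q.items (I i)) ≤ 10 * Q.L := by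
  have hg := hQ.g_pos
  set G := gap Q.key (Q.splitters I j) v with hG
  have hGc : G.OrdConnected := ordConnected_gap _ _ _
  rcases Nat.eq_zero_or_pos (∑ i, cnt (fun x => Q.key x ∈ G) (Q.items (I i))) with h0 | h0
  · rw [h0]; exact Nat.zero_le _
  obtain ⟨i₀, -, hi₀⟩ := Finset.exists_ne_zero_of_sum_ne_zero h0.ne'
  obtain ⟨x₀, -, hx₀⟩ := cnt_pos.1 (Nat.pos_of_ne_zero hi₀)
  set F := recv (Q.msg3 I) j with hF
  set b := rank Q.key F (Q.key x₀) with hb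
  have hbg : b < Q.g := (cnt_le_length _ _).trans_lt (length_recv_msg3_lt hQ hI j)
  have hsplit : ∀ k, rank Q.key (Q.splitters I j) k =
      rank Q.key F k + rank Q.key (recv (Q.msg7 I) j) k := fun k => cnt_append _ _ _
  -- The rank is a sum of two monotone ranks; where the sum is constant, so is each summand.
  have hGb : ∀ k ∈ G, rank Q.key F k = b := by
    intro k hk
    have e1 := hsplit k
    have e2 := hsplit (Q.key x₀)
    rw [hk.1] at e1
    rw [hx₀.1] at e2
    rcases le_total k (Q.key x₀) with h | h
    · have := rank_mono Q.key F h
      have := rank_mono Q.key (recv (Q.msg7 I) j) h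
      omega
    · have := rank_mono Q.key F h
      have := rank_mono Q.key (recv (Q.msg7 I) j) h
      omega
  have hbm : b < m := hbg.trans_le hQ.g_le
  let β : Fin m := ⟨b, hbm⟩
  have h1 : ∀ i, cnt (fun x => Q.key x ∈ G) (Q.items (I i)) =
      ∑ k : Fin m, if (k : ℕ) / Q.g = b then cnt (fun x => Q.key x ∈ G) (Q.msg4 I i k) else 0 := by
    intro i
    have e : cnt (fun x => Q.key x ∈ G) (Q.items (I i)) =
        cnt (fun x => Q.key x ∈ G) (sel (fun x => rank Q.key F (Q.key x) = b) (Q.items (I i))) := by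
      rw [cnt_sel]
      exact cnt_congr fun x _ => ⟨fun h => ⟨h, hGb _ h⟩, And.left⟩
    rw [e, ← sum_cnt_chunk hg, ← sum_fin_div_eq hg b ((Nat.mul_le_mul_right _ hbg).trans hQ.sq_le)]
    refine Finset.sum_congr rfl fun k _ => ?_
    split_ifs with hk
    · rw [msg4, hk]; rfl
    · rfl
  have h2 : ∑ i, cnt (fun x => Q.key x ∈ G) (Q.items (I i)) =
      ∑ k : Fin m, if (k : ℕ) / Q.g = b then cnt (fun x => Q.key x ∈ G) (recv (Q.msg4 I) k)
        else 0 := by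
    simp only [h1]
    rw [Finset.sum_comm]
    refine Finset.sum_congr rfl fun k _ => ?_
    split_ifs
    · rw [cnt_recv]
    · simp
  have h3 : ∑ i, cnt (fun x => Q.key x ∈ G) (Q.items (I i)) ≤
      Q.g * cnt (fun x => Q.key x ∈ G) (recv (Q.msg5 I) β) + Q.g * Q.g := by
    rw [h2]
    calc _ ≤ ∑ k : Fin m, (Q.g * cnt (fun x => Q.key x ∈ G) (Q.msg5 I k β) +
          if (k : ℕ) / Q.g = b then Q.g else 0) := by
          refine Finset.sum_le_sum fun k _ => ?_
          split_ifs with h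
          · have := cnt_le_cnt_sample Q.key hg (recv (Q.msg4 I) k) hGc
            rw [mul_add, mul_one] at this
            simpa [msg5, β, h] using this
          · exact Nat.zero_le _
      _ ≤ _ := by
          rw [Finset.sum_add_distrib, ← Finset.mul_sum, cnt_recv]
          exact Nat.add_le_add_left (sum_fin_group_le hg b Q.g (fun _ => Q.g) fun _ => le_rfl) _
  have h4 : cnt (fun x => Q.key x ∈ G) (recv (Q.msg5 I) β) ≤ 8 * Q.L / Q.g + 1 := by
    have := cnt_le_cnt_sample Q.key (Nat.succ_pos (8 * Q.L / Q.g)) (recv (Q.msg5 I) β) hGc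
    have hsub : sample Q.key (8 * Q.L / Q.g + 1) (recv (Q.msg5 I) β) ⊆ Q.splitters I j :=
      fun x hx => List.mem_append_right _ (sample_subset_recv_msg7 hQ hI β j hbg hx)
    rw [hG, cnt_gap_self _ _ _ hsub] at this
    simpa using this
  have e1 := Nat.mul_le_mul_left Q.g h4
  rw [mul_add, mul_one] at e1
  have e2 := Nat.mul_div_le (8 * Q.L) Q.g
  have := hQ.sq_le_L
  have := hQ.g_le_L
  omega

/-- Each of the three ranks of an owner contributes `10 * L` items from its gap and at most `m ≤ L`
copies of one splitter key. -/
theorem length_recv_msg8_le [Nonempty κ] (j : Fin m) :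
    (recv (Q.msg8 I) j).length ≤ 33 * Q.L := by
  have h1 : ∀ v, ∑ i, cnt (fun x => rank Q.key (Q.splitters I j) (Q.key x) = v) (Q.items (I i)) ≤
      11 * Q.L := by
    intro v
    have e1 := sum_cnt_rank_le Q.key (Q.splitters I j) v (fun i => Q.items (I i))
      fun i k => cnt_items_le _ _
    have e2 := sum_cnt_gap_splitters_le hQ hI j v
    have := hQ.m_le
    omega
  have h2 : ∀ l : List (E × ℕ),
      cnt (fun x => rank Q.key (Q.splitters I j) (Q.key x) / 3 = j) l ≤
      cnt (fun x => rank Q.key (Q.splitters I j) (Q.key x) = 3 * j) l +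
      cnt (fun x => rank Q.key (Q.splitters I j) (Q.key x) = 3 * j + 1) l +
      cnt (fun x => rank Q.key (Q.splitters I j) (Q.key x) = 3 * j + 2) l := by
    intro l
    induction l with
    | nil => simp
    | cons x l ih =>
      simp only [cnt_cons]
      split_ifs <;> omega
  rw [length_recv]
  calc _ = ∑ i, cnt (fun x => rank Q.key (Q.splitters I j) (Q.key x) / 3 = j) (Q.items (I i)) :=
        Finset.sum_congr rfl fun i _ => length_sel _ _
    _ ≤ _ := Finset.sum_le_sum fun i _ => h2 _
    _ ≤ 33 * Q.L := by
        simp only [Finset.sum_add_distrib]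
        have e0 := h1 (3 * j)
        have e1 := h1 (3 * j + 1)
        have e2 := h1 (3 * j + 2)
        omega

omit hI hQ in
theorem sum_length_msg8_le (i : Fin m) : ∑ j, (Q.msg8 I i j).length ≤ (Q.items (I i)).length :=
  sum_length_sel_fiber_le m _ _

omit hI in
-- By `Fits.self` the cell of a point is among the cells announced for it, so the balance achieved
-- for announcements carries over to points.
theorem length_msg9_le (i j : Fin m) : (Q.msg9 I i j).length ≤ Q.minPts * (Q.msg8 I i j).length := by
  refine length_le_mul_of_cnt_key_le Q.key _ _ _ (fun k => ?_) fun x hx => ?_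
  · refine (cnt_le_of_sublist _ (sel_sublist _ _)).trans ?_
    rw [cnt_trunc]
    exact min_le_left _ _
  · rw [msg9, mem_sel] at hx
    obtain ⟨p, hp, rfl⟩ := List.mem_map.1 ((trunc_sublist _ _ _).subset hx.1)
    obtain ⟨a, ha, hpa⟩ := hQ.self p
    obtain ⟨y, hy, hyx⟩ := exists_mem_items hp ha
    refine ⟨y, mem_sel.2 ⟨hy, ?_⟩, hyx.trans hpa⟩
    rw [hyx, hpa]
    exact hx.2

omit hI hQ in
theorem length_msg10_le (i j : Fin m) :
    (Q.msg10 I i j).length ≤ Q.minPts * (Q.msg8 I j i).length := by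
  refine length_le_mul_of_cnt_key_le Q.key _ _ _ (fun k => ?_) fun x hx => (mem_sel.1 hx).2
  refine (cnt_le_of_sublist _ (sel_sublist _ _)).trans ?_
  rw [cnt_trunc]
  exact min_le_left _ _

omit hI hQ in
theorem length_msg11 (i j : Fin m) : (Q.msg11 I i j).length = (Q.msg10 I j i).length :=
  List.length_map ..

omit hI hQ in
theorem length_msg12 (i j : Fin m) : (Q.msg12 I i j).length = (Q.msg10 I i j).length := by
  rw [msg12, List.length_map, length_msg11]

theorem sum_length_msg10_le [Nonempty κ] (i : Fin m) :
    ∑ j, (Q.msg10 I i j).length ≤ Q.minPts * (33 * Q.L) := by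
  refine (Finset.sum_le_sum fun j _ => length_msg10_le i j).trans ?_
  rw [← Finset.mul_sum, ← length_recv]
  exact Nat.mul_le_mul_left _ (length_recv_msg8_le hQ hI i)

omit hQ in
theorem length_recv_msg10_le (j : Fin m) : (recv (Q.msg10 I) j).length ≤ Q.minPts * Q.L := by
  rw [length_recv]
  refine (Finset.sum_le_sum fun i _ => length_msg10_le i j).trans ?_
  rw [← Finset.mul_sum]
  exact Nat.mul_le_mul_left _ ((sum_length_msg8_le j).trans (hI j))

/-- No machine receives too many items in a round. -/
theorem length_recv_msg_le [Nonempty κ] (t : ℕ) (j : Fin m) :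
    ∑ i, (Q.msg I t i j).length ≤ 33 * (Q.minPts + 1) * Q.L := by
  rw [← length_recv]
  have hm := hQ.m_le
  have e : 33 * (Q.minPts + 1) * Q.L = Q.minPts * (33 * Q.L) + 33 * Q.L := by ring
  have e' : Q.minPts * (33 * Q.L) = 33 * (Q.minPts * Q.L) := by ring
  have hL := hQ.g_le_L
  have hg := hQ.g_pos
  rw [e]
  match t with
  | 0 => exact (length_recv_msg0_le hQ hI j).trans (by omega)
  | 1 => exact (length_recv_msg1_le hQ hI j).trans (by omega)
  | 2 => exact (length_recv_msg2_le j).trans (by omega)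
  | 3 => exact (length_recv_msg3_lt hQ hI j).le.trans (by omega)
  | 4 => exact (length_recv_msg4_le hQ hI j).trans (by omega)
  | 5 => exact (length_recv_msg5_le hQ hI j).trans (by omega)
  | 6 => exact (length_recv_msg6_le j).trans (by omega)
  | 7 => exact (length_recv_msg7_le j).trans (by omega)
  | 8 => exact (length_recv_msg8_le hQ hI j).trans (by omega)
  | 9 =>
    have : (recv (Q.msg9 I) j).length ≤ Q.minPts * (33 * Q.L) := by
      rw [length_recv]
      refine (Finset.sum_le_sum fun i _ => length_msg9_le hQ i j).trans ?_
      rw [← Finset.mul_sum, ← length_recv]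
      exact Nat.mul_le_mul_left _ (length_recv_msg8_le hQ hI j)
    exact this.trans (by omega)
  | 10 => exact (length_recv_msg10_le hI j).trans (by omega)
  | 11 =>
    show (recv (Q.msg11 I) j).length ≤ _
    rw [length_recv]
    simp only [length_msg11]
    exact (sum_length_msg10_le hQ hI j).trans (by omega)
  | 12 =>
    show (recv (Q.msg12 I) j).length ≤ _
    rw [length_recv]
    simp only [length_msg12]
    rw [← length_recv]
    exact (length_recv_msg10_le hI j).trans (by omega)
  | t + 13 => simp [msg, recv]

/-- No machine sends too many items in a round. -/
theorem sum_length_msg_le [Nonempty κ] (hI' : ∀ i, (I i).length ≤ Q.L) (t : ℕ) (i : Fin m) :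
    ∑ j, (Q.msg I t i j).length ≤ 33 * (Q.minPts + 1) * Q.L := by
  have hm := hQ.m_le
  have e : 33 * (Q.minPts + 1) * Q.L = Q.minPts * (33 * Q.L) + 33 * Q.L := by ring
  have e' : Q.minPts * (33 * Q.L) = 33 * (Q.minPts * Q.L) := by ring
  have hL := hQ.g_le_L
  have hg := hQ.g_pos
  rw [e]
  have one : ∀ f : Fin m → ℕ, (∀ j, f j ≤ 1) → ∑ j, f j ≤ m := fun f hf =>
    (Finset.sum_le_sum fun j _ => hf j).trans (by simp)
  have eqk : ∀ (k B : ℕ) (f : Fin m → ℕ), (∀ j, f j ≤ B) →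
      ∑ j : Fin m, (if k = (j : ℕ) then f j else 0) ≤ B := fun k B f hf => by
    have := sum_fin_group_le one_pos k B f hf
    simpa [eq_comm] using this
  match t with
  | 0 =>
    simp only [msg, msg0, apply_ite List.length, List.length_nil]
    refine (eqk _ Q.L _ fun j => ?_).trans (by omega)
    exact ((length_sample_le _ hg _).trans (Nat.div_le_self _ _)).trans (hI i)
  | 1 =>
    simp only [msg, msg1, apply_ite List.length, List.length_nil, eq_comm (b := 0)]
    refine (eqk _ (3 * Q.L) _ fun j => ?_).trans (by omega)
    exact ((length_sample_le _ hg _).trans (Nat.div_le_self _ _)).trans (length_recv_msg0_le hQ hI i)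
  | 2 => exact (one _ fun j => length_toList_getElem?_le _ _).trans (by omega)
  | 3 => exact (one _ fun j => length_recv_msg2_le i).trans (by omega)
  | 4 =>
    -- Sorting the recipients by group shows that each coarse bucket is dealt at most once, so the
    -- total is at most the number of items.
    have h : ∀ j : Fin m, (Q.msg4 I i j).length = ∑ b : Fin m, if (j : ℕ) / Q.g = b then
        cnt (fun _ => True) (chunk Q.g (j % Q.g)
          (sel (fun x => rank Q.key (recv (Q.msg3 I) i) (Q.key x) = b) (Q.items (I i)))) else 0 := by
      intro j
      rw [Finset.sum_eq_single ⟨(j : ℕ) / Q.g, (Nat.div_le_self _ _).trans_lt j.2⟩]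
      · rw [if_pos rfl, cnt_true]; rfl
      · intro b _ hb
        rw [if_neg fun h => hb (Fin.ext h.symm)]
      · simp
    simp only [msg, h]
    rw [Finset.sum_comm]
    have h2 : ∀ b : Fin m, _ ≤ _ := fun b => (sum_fin_div_eq_le (m := m) hg b fun k =>
      cnt (fun _ => True) (chunk Q.g k
        (sel (fun x => rank Q.key (recv (Q.msg3 I) i) (Q.key x) = b) (Q.items (I i))))).trans_eq
      ((sum_cnt_chunk hg _ _).trans (cnt_true _))
    refine (Finset.sum_le_sum fun b _ => h2 b).trans ?_
    refine (sum_length_sel_fiber_le m _ _).trans ((hI i).trans (by omega))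
  | 5 =>
    simp only [msg, msg5, apply_ite List.length, List.length_nil]
    refine (eqk _ (8 * Q.L) _ fun j => ?_).trans (by omega)
    exact ((length_sample_le _ hg _).trans (Nat.div_le_self _ _)).trans (length_recv_msg4_le hQ hI i)
  | 6 =>
    refine (one _ fun j => ?_).trans (by omega)
    show (Q.msg6 I i j).length ≤ 1
    rw [msg6]
    split_ifs
    · exact length_toList_getElem?_le _ _
    · simp
  | 7 => exact (one _ fun j => length_recv_msg6_le i).trans (by omega)
  | 8 => exact (sum_length_msg8_le i).trans ((hI i).trans (by omega))
  | 9 =>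
    refine (sum_length_sel_fiber_le m _ _).trans ?_
    refine (trunc_sublist _ _ _).length_le.trans ?_
    rw [List.length_map]
    exact (hI' i).trans (by omega)
  | 10 => exact (sum_length_msg10_le hQ hI i).trans (by omega)
  | 11 =>
    simp only [msg, length_msg11]
    rw [← length_recv]
    exact (length_recv_msg10_le hI i).trans (by omega)
  | 12 =>
    simp only [msg, length_msg12]
    exact (sum_length_msg10_le hQ hI i).trans (by omega)
  | t + 13 => simp [msg]

end Loads

end Protocol

end MPC

/-! ### Content and locality of the messages, correctness of the labels. -/

namespace MPC

theorem mem_trunc {X κ : Type*} (key : X → κ) (N : ℕ) {l : List X} {x : X} (hx : x ∈ l)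
    (h : cnt (fun y => key y = key x) l ≤ N) : x ∈ trunc key N l := by
  classical
  induction l with
  | nil => simp at hx
  | cons z l ih =>
    rw [cnt_cons] at h
    rw [trunc]
    rcases List.mem_cons.1 hx with rfl | hx
    · rw [if_pos rfl] at h
      have := cnt_le_of_sublist (fun y => key y = key x) (trunc_sublist key N l)
      rw [if_pos (by omega)]
      exact List.mem_cons_self
    · have := ih hx (by omega)
      split_ifs
      · exact List.mem_cons_of_mem _ this
      · exact this

/-- Truncating at the senders and again at the owner leaves the same count as truncating once
globally. -/
theorem min_sum_min {ι : Type*} (N : ℕ) (s : Finset ι) (f : ι → ℕ) :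
    min N (∑ i ∈ s, min N (f i)) = min N (∑ i ∈ s, f i) := by
  classical
  induction s using Finset.induction_on with
  | empty => simp
  | insert a s ha ih =>
    rw [Finset.sum_insert ha, Finset.sum_insert ha]
    omega

theorem recv_congr {X : Type*} {m : ℕ} {M M' : Fin m → Fin m → List X} {i : Fin m}
    (h : ∀ j, M j i = M' j i) : recv M i = recv M' i := by
  simp only [recv, h]

theorem sum_sel_flatMap {m : ℕ} {E : Type*} (p : E × ℕ → Prop) (f : Fin m → List (E × ℕ)) :
    ((sel p ((List.finRange m).flatMap f)).map Prod.snd).sum =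
      ∑ j, ((sel p (f j)).map Prod.snd).sum := by
  rw [← List.sum_ofFn, List.ofFn_eq_map]
  generalize List.finRange m = J
  induction J with
  | nil => simp [sel]
  | cons j J ih =>
    simp only [sel] at ih
    simp [sel, ih]

theorem sum_sel_map {X E : Type*} (f : X → E) (v : E → ℕ) (p : E) (l : List X) :
    ((sel (fun r : E × ℕ => r.1 = p) (l.map fun q => (f q, v (f q)))).map Prod.snd).sum =
      v p * cnt (fun q => f q = p) l := by
  classical
  induction l with
  | nil => simp [sel]
  | cons x l ih =>
    simp only [sel] at ih
    by_cases h : f x = p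
    · simp only [sel, List.map_cons, h, decide_true, List.filter_cons_of_pos, List.sum_cons, ih,
        cnt_cons, if_true]
      ring
    · simp [sel, List.map_cons, h, ih, cnt_cons]

namespace Protocol

variable {E κ : Type*} [LinearOrder κ] {m : ℕ} {Q : Protocol E κ} {I : Fin m → List E}

section Content

variable {i j : Fin m} {x : E × ℕ}

theorem mem_of_mem_msg0 (h : x ∈ Q.msg0 I i j) : x ∈ Q.items (I i) := by
  rw [msg0] at h
  split_ifs at h
  · exact sample_subset _ _ _ h
  · simp at h

theorem mem_of_mem_msg1 (h : x ∈ Q.msg1 I i j) : x ∈ recv (Q.msg0 I) i := by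
  rw [msg1] at h
  split_ifs at h
  · exact sample_subset _ _ _ h
  · simp at h

theorem mem_of_mem_msg2 (h : x ∈ Q.msg2 I i j) : x ∈ recv (Q.msg1 I) i := by
  rw [msg2, Option.mem_toList] at h
  exact sample_subset _ _ _ (List.mem_of_getElem? h)

theorem mem_of_mem_msg4 (h : x ∈ Q.msg4 I i j) : x ∈ Q.items (I i) :=
  (mem_sel.1 (chunk_subset _ _ _ h)).1

theorem mem_of_mem_msg5 (h : x ∈ Q.msg5 I i j) : x ∈ recv (Q.msg4 I) i := by
  rw [msg5] at h
  split_ifs at h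
  · exact sample_subset _ _ _ h
  · simp at h

theorem mem_of_mem_msg6 (h : x ∈ Q.msg6 I i j) : x ∈ recv (Q.msg5 I) i := by
  rw [msg6] at h
  split_ifs at h
  · rw [Option.mem_toList] at h
    exact sample_subset _ _ _ (List.mem_of_getElem? h)
  · simp at h

theorem mem_of_mem_msg8 (h : x ∈ Q.msg8 I i j) : x ∈ Q.items (I i) := (mem_sel.1 h).1

theorem mem_of_mem_msg9 (h : x ∈ Q.msg9 I i j) : x.1 ∈ I i ∧ x.2 = Q.c := by
  obtain ⟨p, hp, rfl⟩ := List.mem_map.1 ((trunc_sublist _ _ _).subset (mem_sel.1 h).1)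
  exact ⟨hp, rfl⟩

theorem mem_of_mem_msg10 (h : x ∈ Q.msg10 I i j) : x ∈ recv (Q.msg9 I) i :=
  (trunc_sublist _ _ _).subset (mem_sel.1 h).1

theorem mem_msg11 : x ∈ Q.msg11 I i j ↔
    ∃ q ∈ Q.msg10 I j i, (q.1, cnt (fun p => Q.near q.1 p) (I i)) = x := List.mem_map

theorem mem_msg12 : x ∈ Q.msg12 I i j ↔ ∃ q ∈ Q.msg11 I j i,
    (q.1, ((sel (fun r => r.1 = q.1) (recv (Q.msg11 I) i)).map Prod.snd).sum) = x := List.mem_map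

/-- Machines only send points that they know. -/
theorem fst_mem_of_mem_msg (t : ℕ) (h : x ∈ Q.msg I t i j) :
    x.1 ∈ I i ∨ ∃ s < t, ∃ k, ∃ y ∈ Q.msg I s k i, y.1 = x.1 := by
  have key : ∀ s < t, x ∈ recv (Q.msg I s) i →
      x.1 ∈ I i ∨ ∃ s < t, ∃ k, ∃ y ∈ Q.msg I s k i, y.1 = x.1 := fun s hs hx => by
    obtain ⟨k, hk⟩ := mem_recv.1 hx
    exact Or.inr ⟨s, hs, k, x, hk, rfl⟩
  match t with
  | 0 => exact Or.inl (fst_mem_of_mem_items (mem_of_mem_msg0 h)).1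
  | 1 => exact key 0 (by omega) (mem_of_mem_msg1 h)
  | 2 => exact key 1 (by omega) (mem_of_mem_msg2 h)
  | 3 => exact key 2 (by omega) h
  | 4 => exact Or.inl (fst_mem_of_mem_items (mem_of_mem_msg4 h)).1
  | 5 => exact key 4 (by omega) (mem_of_mem_msg5 h)
  | 6 => exact key 5 (by omega) (mem_of_mem_msg6 h)
  | 7 => exact key 6 (by omega) h
  | 8 => exact Or.inl (fst_mem_of_mem_items (mem_of_mem_msg8 h)).1
  | 9 => exact Or.inl (mem_of_mem_msg9 h).1
  | 10 => exact key 9 (by omega) (mem_of_mem_msg10 h)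
  | 11 =>
    obtain ⟨q, hq, rfl⟩ := mem_msg11.1 h
    exact Or.inr ⟨10, by omega, j, q, hq, rfl⟩
  | 12 =>
    obtain ⟨q, hq, rfl⟩ := mem_msg12.1 h
    exact Or.inr ⟨11, by omega, j, q, hq, rfl⟩
  | t + 13 => simp [msg] at h

/-- The numbers in the messages are small. -/
theorem snd_le_of_mem_msg [Nonempty κ] (hQ : Q.Fits m) (hI : ∀ i, (Q.items (I i)).length ≤ Q.L)
    (hI' : ∀ i, (I i).length ≤ Q.L) (t : ℕ) (h : x ∈ Q.msg I t i j) :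
    x.2 ≤ Q.c + Q.L + Q.minPts * (33 * Q.L) * Q.L := by
  have h0 : ∀ {i j x}, x ∈ Q.msg0 I i j → x.2 < Q.c := fun h =>
    (fst_mem_of_mem_items (mem_of_mem_msg0 h)).2
  have h1 : ∀ {i j x}, x ∈ Q.msg1 I i j → x.2 < Q.c := fun h => by
    obtain ⟨k, hk⟩ := mem_recv.1 (mem_of_mem_msg1 h)
    exact h0 hk
  have h2 : ∀ {i j x}, x ∈ Q.msg2 I i j → x.2 < Q.c := fun h => by
    obtain ⟨k, hk⟩ := mem_recv.1 (mem_of_mem_msg2 h)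
    exact h1 hk
  have h4 : ∀ {i j x}, x ∈ Q.msg4 I i j → x.2 < Q.c := fun h =>
    (fst_mem_of_mem_items (mem_of_mem_msg4 h)).2
  have h5 : ∀ {i j x}, x ∈ Q.msg5 I i j → x.2 < Q.c := fun h => by
    obtain ⟨k, hk⟩ := mem_recv.1 (mem_of_mem_msg5 h)
    exact h4 hk
  have h6 : ∀ {i j x}, x ∈ Q.msg6 I i j → x.2 < Q.c := fun h => by
    obtain ⟨k, hk⟩ := mem_recv.1 (mem_of_mem_msg6 h)
    exact h5 hk
  have h11 : ∀ {i j x}, x ∈ Q.msg11 I i j → x.2 ≤ Q.L := fun {i j x} h => by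
    obtain ⟨q, hq, rfl⟩ := mem_msg11.1 h
    exact (cnt_le_length _ _).trans (hI' i)
  match t with
  | 0 => have := h0 h; omega
  | 1 => have := h1 h; omega
  | 2 => have := h2 h; omega
  | 3 =>
    obtain ⟨k, hk⟩ := mem_recv.1 h
    have := h2 hk
    omega
  | 4 => have := h4 h; omega
  | 5 => have := h5 h; omega
  | 6 => have := h6 h; omega
  | 7 =>
    obtain ⟨k, hk⟩ := mem_recv.1 h
    have := h6 hk
    omega
  | 8 => have := (fst_mem_of_mem_items (mem_of_mem_msg8 h)).2; omega
  | 9 => have := (mem_of_mem_msg9 h).2; omega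
  | 10 =>
    obtain ⟨k, hk⟩ := mem_recv.1 (mem_of_mem_msg10 h)
    have := (mem_of_mem_msg9 hk).2
    omega
  | 11 => have := h11 h; omega
  | 12 =>
    obtain ⟨q, hq, rfl⟩ := mem_msg12.1 h
    have e1 : ((sel (fun r => r.1 = q.1) (recv (Q.msg11 I) i)).map Prod.snd).sum ≤
        (recv (Q.msg11 I) i).length * Q.L := by
      refine (List.sum_le_card_nsmul _ Q.L fun y hy => ?_).trans ?_
      · obtain ⟨r, hr, rfl⟩ := List.mem_map.1 hy
        obtain ⟨k, hk⟩ := mem_recv.1 (mem_sel.1 hr).1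
        exact h11 hk
      · rw [List.length_map, smul_eq_mul]
        exact Nat.mul_le_mul_right _ (sel_sublist _ _).length_le
    have e2 : (recv (Q.msg11 I) i).length ≤ Q.minPts * (33 * Q.L) := by
      rw [length_recv]
      simp only [length_msg11]
      exact sum_length_msg10_le hQ hI i
    have := Nat.mul_le_mul_right Q.L e2
    show ((sel (fun r => r.1 = q.1) (recv (Q.msg11 I) i)).map Prod.snd).sum ≤ _
    omega
  | t + 13 => simp [msg] at h

end Content

/-- The messages of a machine depend only on what it knows. -/
theorem msg_congr {I I' : Fin m → List E} (t : ℕ) (i : Fin m) (h : I i = I' i)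
    (hr : ∀ s < t, ∀ j, Q.msg I s j i = Q.msg I' s j i) (j : Fin m) :
    Q.msg I t i j = Q.msg I' t i j := by
  have key : ∀ s < t, recv (Q.msg I s) i = recv (Q.msg I' s) i := fun s hs =>
    recv_congr (hr s hs)
  match t with
  | 0 => simp only [msg, msg0, h]
  | 1 => have := key 0 (by omega); simp only [msg] at this; simp only [msg, msg1, this]
  | 2 => have := key 1 (by omega); simp only [msg] at this; simp only [msg, msg2, this]
  | 3 => have := key 2 (by omega); simp only [msg] at this; simp only [msg, msg3, this]
  | 4 => have := key 3 (by omega); simp only [msg] at this; simp only [msg, msg4, this, h]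
  | 5 => have := key 4 (by omega); simp only [msg] at this; simp only [msg, msg5, this]
  | 6 => have := key 5 (by omega); simp only [msg] at this; simp only [msg, msg6, this]
  | 7 => have := key 6 (by omega); simp only [msg] at this; simp only [msg, msg7, this]
  | 8 =>
    have h3 := key 3 (by omega)
    have h7 := key 7 (by omega)
    simp only [msg] at h3 h7
    simp only [msg, msg8, owner, splitters, h3, h7, h]
  | 9 =>
    have h3 := key 3 (by omega)
    have h7 := key 7 (by omega)
    simp only [msg] at h3 h7
    simp only [msg, msg9, owner, splitters, h3, h7, h]
  | 10 =>
    have h8 := hr 8 (by omega) j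
    have h9 := key 9 (by omega)
    simp only [msg] at h8 h9
    simp only [msg, msg10, h8, h9]
  | 11 =>
    have h10 := hr 10 (by omega) j
    simp only [msg] at h10
    simp only [msg, msg11, h10, h]
  | 12 =>
    have h11 := hr 11 (by omega) j
    have h11' := key 11 (by omega)
    simp only [msg] at h11 h11'
    simp only [msg, msg12, h11, h11']
  | t + 13 => simp only [msg]

theorem out_congr {I I' : Fin m → List E} (i : Fin m) (h : I i = I' i)
    (hr : ∀ s < 13, ∀ j, Q.msg I s j i = Q.msg I' s j i) : Q.out I i = Q.out I' i := by
  have h10 := recv_congr (hr 10 (by omega))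
  have h12 := recv_congr (hr 12 (by omega))
  simp only [msg] at h10 h12
  rw [out, out, h10, h12, h]

section Correctness

variable (hQ : Q.Fits m) (hI : ∀ i, (Q.items (I i)).length ≤ Q.L)
  (hnear : ∀ p q, Q.key (p, Q.c) = Q.key (q, Q.c) → Q.near p q)
  (hkey : ∀ p q, Q.near p q → ∃ a < Q.c, Q.key (q, a) = Q.key (p, Q.c))
  (hnd : ∀ p, ∑ i, cnt (fun q => q = p) (I i) ≤ 1)

theorem cnt_key_recv_msg9 (o : Fin m) (k : κ) (ho : Q.owner I o k = o) :
    cnt (fun x => Q.key x = k) (recv (Q.msg9 I) o) =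
      ∑ i, min Q.minPts (cnt (fun p => Q.key (p, Q.c) = k) (I i)) := by
  rw [cnt_recv]
  refine Finset.sum_congr rfl fun i _ => ?_
  rw [msg9, cnt_sel, ← cnt_map (fun x => Q.key x = k) (fun p => (p, Q.c)), ← cnt_trunc]
  refine cnt_congr fun x _ => ⟨And.left, fun h => ⟨h, ?_⟩⟩
  rw [h]
  -- Broadcasts do not depend on the recipient, so `Q.owner I i` and `Q.owner I o` agree by
  -- definition.
  exact ho

theorem exists_mem_msg8 {i o : Fin m} {p : E} (hp : p ∈ I i) {a : ℕ} (ha : a < Q.c) {k : κ}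
    (hk : Q.key (p, a) = k) (ho : Q.owner I o k = o) : ∃ y ∈ Q.msg8 I i o, Q.key y = k := by
  obtain ⟨y, hy, hyk⟩ := exists_mem_items hp ha
  refine ⟨y, mem_sel.2 ⟨hy, ?_⟩, hyk.trans hk⟩
  rw [hyk, hk]
  exact ho

/-- Only the owner of `k` can return points of key `k`, because `msg9` sends such points nowhere
else. -/
theorem cnt_key_recv_msg10 {i o : Fin m} {k : κ} (ho : Q.owner I o k = o)
    (hreq : ∃ y ∈ Q.msg8 I i o, Q.key y = k) :
    cnt (fun x => Q.key x = k) (recv (Q.msg10 I) i) =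
      min Q.minPts (∑ i, cnt (fun p => Q.key (p, Q.c) = k) (I i)) := by
  rw [cnt_recv, Finset.sum_eq_single o]
  · rw [← min_sum_min, ← cnt_key_recv_msg9 o k ho, ← cnt_trunc, msg10, cnt_sel]
    refine cnt_congr fun x _ => ⟨And.left, fun h => ⟨h, ?_⟩⟩
    rw [h]
    exact hreq
  · intro j _ hj
    refine cnt_eq_zero.2 fun x hx hxk => hj ?_
    obtain ⟨l, hl⟩ := mem_recv.1 (mem_of_mem_msg10 hx)
    have := (mem_sel.1 hl).2
    rw [hxk] at this
    exact Fin.ext (this.symm.trans ho)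
  · simp

-- The totals are exact even in dense cells: once the owner keeps `p`, every machine with a point
-- near `p` has announced the cell of `p` by `hkey`, is shown `p`, and reports. It reports only
-- once, because `p` occurs once in the input.
include hkey hnd in
theorem snd_eq_of_mem_msg12 {i j : Fin m} {r : E × ℕ} (hr : r ∈ Q.msg12 I j i) :
    r.2 = ∑ l, cnt (fun p => Q.near r.1 p) (I l) := by
  obtain ⟨q, hq, rfl⟩ := mem_msg12.1 hr
  obtain ⟨x, hx, rfl⟩ := mem_msg11.1 hq
  obtain ⟨n, hn⟩ := mem_recv.1 (mem_of_mem_msg10 hx)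
  obtain ⟨p, a⟩ := x
  obtain rfl : a = Q.c := (mem_of_mem_msg9 hn).2
  have ho : Q.owner I j (Q.key (p, Q.c)) = j := (mem_sel.1 hn).2
  have hT := (mem_sel.1 hx).1
  have h1 : cnt (fun x : E × ℕ => x.1 = p) (trunc Q.key Q.minPts (recv (Q.msg9 I) j)) ≤ 1 := by
    refine (cnt_le_of_sublist _ (trunc_sublist _ _ _)).trans (le_trans ?_ (hnd p))
    rw [cnt_recv]
    refine Finset.sum_le_sum fun l _ => ?_
    refine (cnt_le_of_sublist _ ((sel_sublist _ _).trans (trunc_sublist _ _ _))).trans ?_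
    rw [cnt_map]
  show ((sel (fun r => r.1 = p) (recv (Q.msg11 I) j)).map Prod.snd).sum =
    ∑ l, cnt (fun q => Q.near p q) (I l)
  rw [recv, sum_sel_flatMap]
  refine Finset.sum_congr rfl fun l _ => ?_
  rw [msg11, sum_sel_map Prod.fst (fun e => cnt (fun q => Q.near e q) (I l)) p]
  -- A machine without near points contributes zero, whether or not it is shown `p`.
  rcases Nat.eq_zero_or_pos (cnt (fun q => Q.near p q) (I l)) with h0 | h0
  · rw [h0, zero_mul]
  · obtain ⟨q, hq, hpq⟩ := cnt_pos.1 h0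
    obtain ⟨a, ha, hak⟩ := hkey p q hpq
    have h2 : (p, Q.c) ∈ Q.msg10 I j l := mem_sel.2 ⟨hT, exists_mem_msg8 hq ha hak ho⟩
    have h3 : 0 < cnt (fun x : E × ℕ => x.1 = p) (Q.msg10 I j l) := cnt_pos.2 ⟨_, h2, rfl⟩
    have h4 : cnt (fun x : E × ℕ => x.1 = p) (Q.msg10 I j l) ≤ 1 :=
      (cnt_le_of_sublist _ (sel_sublist _ _)).trans h1
    rw [show cnt (fun x : E × ℕ => x.1 = p) (Q.msg10 I j l) = 1 from le_antisymm h4 h3, mul_one]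

include hQ hI hnear hkey hnd in
/-- The labels are correct. -/
theorem snd_eq_true_iff_of_mem_out [Nonempty κ] {i : Fin m} {q : E × Bool} (hq : q ∈ Q.out I i) :
    q.2 = true ↔ Q.minPts ≤ ∑ l, cnt (fun p => Q.near q.1 p) (I l) := by
  obtain ⟨p, hp, rfl⟩ := List.mem_map.1 hq
  simp only [decide_eq_true_eq]
  set k := Q.key (p, Q.c) with hk
  obtain ⟨a, ha, hak⟩ := hQ.self p
  let o : Fin m := ⟨Q.owner I i k, owner_lt hQ hI i k⟩
  have ho : Q.owner I o k = o := rfl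
  have hreq : ∃ y ∈ Q.msg8 I i o, Q.key y = k := exists_mem_msg8 hp ha hak ho
  rw [cnt_key_recv_msg10 ho hreq]
  constructor
  · rintro (h | ⟨r, hr, rfl, h⟩)
    · refine (h.trans (min_le_right _ _)).trans (Finset.sum_le_sum fun l _ => ?_)
      exact cnt_mono fun q _ h => hnear p q h.symm
    · obtain ⟨j, hj⟩ := mem_recv.1 hr
      rwa [← snd_eq_of_mem_msg12 hkey hnd hj]
  · intro h
    -- In a sparse cell neither truncation removes anything, so `p` reaches its owner and a total
    -- for it comes back.
    by_cases hd : Q.minPts ≤ ∑ l, cnt (fun p => Q.key (p, Q.c) = k) (I l)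
    · exact Or.inl (le_min le_rfl hd)
    · right
      push Not at hd
      have h1 : (p, Q.c) ∈ Q.msg9 I i o := by
        refine mem_sel.2 ⟨mem_trunc _ _ (List.mem_map.2 ⟨p, hp, rfl⟩) ?_, ho⟩
        rw [cnt_map]
        exact (Finset.single_le_sum (f := fun l => cnt (fun p => Q.key (p, Q.c) = k) (I l))
          (fun _ _ => Nat.zero_le _) (Finset.mem_univ i)).trans hd.le
      have h2 : (p, Q.c) ∈ Q.msg10 I o i := by
        refine mem_sel.2 ⟨mem_trunc _ _ (mem_recv.2 ⟨i, h1⟩) ?_, hreq⟩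
        rw [← hk, cnt_key_recv_msg9 o k ho]
        exact (Finset.sum_le_sum fun l _ => min_le_right _ _).trans hd.le
      have h3 : (p, cnt (fun q => Q.near p q) (I i)) ∈ Q.msg11 I i o :=
        mem_msg11.2 ⟨_, h2, rfl⟩
      have h4 := mem_msg12.2 ⟨_, h3, rfl⟩
      refine ⟨_, mem_recv.2 ⟨o, h4⟩, rfl, ?_⟩
      rwa [snd_eq_of_mem_msg12 hkey hnd h4]

end Correctness

end Protocol

end MPC

/-! ### Encoding by words and the grid. -/

namespace DBSCAN

open MPC

/-- Lets a machine decode its words, so that locality on the level of points passes to words. -/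
theorem flatMap_injective_of_length {X W : Type*} (f : X → List W) (w : ℕ) (hw : 0 < w)
    (hf : ∀ x, (f x).length = w) (hinj : Function.Injective f) :
    Function.Injective fun l : List X => l.flatMap f := by
  intro l l' h
  dsimp only at h
  induction l generalizing l' with
  | nil =>
    cases l' with
    | nil => rfl
    | cons y l' =>
      have := congrArg List.length h
      simp only [List.flatMap_nil, List.length_nil, List.flatMap_cons, List.length_append, hf] at this
      omega
  | cons x l ih =>
    cases l' with
    | nil =>
      have := congrArg List.length h
      simp only [List.flatMap_nil, List.length_nil, List.flatMap_cons, List.length_append, hf] at this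
      omega
    | cons y l' =>
      rw [List.flatMap_cons, List.flatMap_cons] at h
      obtain ⟨h1, h2⟩ := List.append_inj h ((hf x).trans (hf y).symm)
      rw [hinj h1, ih h2]

section Encoding

variable {d : ℕ}

theorem length_encodePoint (p : EuclideanSpace ℝ (Fin d)) : (encodePoint p).length = d := by
  simp [encodePoint]

theorem encodePoint_injective : Function.Injective (encodePoint (d := d)) := by
  intro p q h
  ext j
  have := congrFun (List.ofFn_injective h) j
  simpa using this

/-- A point with a number is stored in `d + 1` words. -/
def encodeItem (q : EuclideanSpace ℝ (Fin d) × ℕ) : List Word :=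
  encodePoint q.1 ++ [Word.num q.2]

theorem length_encodeItem (q : EuclideanSpace ℝ (Fin d) × ℕ) :
    (encodeItem q).length = d + 1 := by
  simp [encodeItem, length_encodePoint]

theorem encodeItem_injective : Function.Injective (encodeItem (d := d)) := by
  rintro ⟨p, a⟩ ⟨q, b⟩ h
  obtain ⟨h1, h2⟩ := List.append_inj h (by simp [length_encodePoint])
  simp only [List.cons.injEq, Word.num.injEq, and_true] at h2
  exact Prod.ext (encodePoint_injective h1) h2

theorem encodeLabelled_eq (q : EuclideanSpace ℝ (Fin d) × Bool) :
    encodeLabelled q = encodeItem (q.1, if q.2 then 1 else 0) := rfl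

theorem length_flatMap_encodeItem (l : List (EuclideanSpace ℝ (Fin d) × ℕ)) :
    (l.flatMap encodeItem).length = l.length * (d + 1) := by
  simp [List.length_flatMap, length_encodeItem]

theorem length_flatMap_encodeLabelled (l : List (EuclideanSpace ℝ (Fin d) × Bool)) :
    (l.flatMap encodeLabelled).length = l.length * (d + 1) := by
  simp [List.length_flatMap, length_encodeItem, encodeLabelled_eq]

theorem length_flatMap_encodePoint (l : List (EuclideanSpace ℝ (Fin d))) :
    (l.flatMap encodePoint).length = l.length * d := by
  simp [List.length_flatMap, length_encodePoint]

theorem coord_mem_flatMap_encodeItem {l : List (EuclideanSpace ℝ (Fin d) × ℕ)} {x : ℝ} :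
    Word.coord x ∈ l.flatMap encodeItem ↔ ∃ q ∈ l, Word.coord x ∈ encodePoint q.1 := by
  simp [encodeItem]

theorem num_mem_flatMap_encodeItem {l : List (EuclideanSpace ℝ (Fin d) × ℕ)} {k : ℕ} :
    Word.num k ∈ l.flatMap encodeItem ↔ ∃ q ∈ l, q.2 = k := by
  simp [encodeItem, encodePoint, eq_comm]

theorem num_notMem_flatMap_encodePoint {l : List (EuclideanSpace ℝ (Fin d))} {k : ℕ} :
    Word.num k ∉ l.flatMap encodePoint := by
  simp [encodePoint]

end Encoding

section Grid

variable {d : ℕ}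

theorem dist_le_of_forall_abs_sub_le (hd : 1 ≤ d) {ε : ℝ} (hε : 0 ≤ ε)
    (p q : EuclideanSpace ℝ (Fin d)) (h : ∀ j, |p j - q j| ≤ ε / d) : dist p q ≤ ε := by
  have hd' : (1 : ℝ) ≤ d := by exact_mod_cast hd
  rw [EuclideanSpace.dist_eq]
  refine Real.sqrt_le_iff.2 ⟨hε, ?_⟩
  calc ∑ j, dist (p j) (q j) ^ 2 ≤ ∑ _j : Fin d, (ε / d) ^ 2 := by
        refine Finset.sum_le_sum fun j _ => ?_
        rw [Real.dist_eq]
        exact pow_le_pow_left₀ (abs_nonneg _) (h j) 2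
    _ = ε ^ 2 / d := by
        rw [Finset.sum_const, Finset.card_univ, Fintype.card_fin, nsmul_eq_mul]
        field_simp
    _ ≤ ε ^ 2 := div_le_self (sq_nonneg _) hd'

theorem abs_sub_le_dist (p q : EuclideanSpace ℝ (Fin d)) (j : Fin d) : |p j - q j| ≤ dist p q := by
  rw [dist_eq_norm]
  exact PiLp.norm_apply_le (p - q) j

/-- Keys for the cells of a grid: points in the same cell are at distance at most `ε`, and
points at distance at most `ε` lie in neighbouring cells. -/
theorem exists_grid_key (hd : 1 ≤ d) {ε : ℝ} (hε : 0 ≤ ε) :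
    ∃ key : EuclideanSpace ℝ (Fin d) × ℕ → Lex (Fin d → ℝ),
      (∀ p q, key (p, (2 * d + 1) ^ d) = key (q, (2 * d + 1) ^ d) → dist p q ≤ ε) ∧
      ∀ p q, dist p q ≤ ε →
        ∃ a < (2 * d + 1) ^ d, key (q, a) = key (p, (2 * d + 1) ^ d) := by
  have hc : 0 < (2 * d + 1) ^ d := by positivity
  rcases hε.eq_or_lt with rfl | hε
  -- For `ε = 0` the grid degenerates, and a point serves as its own cell. Real keys let both cases
  -- share one type; they are only compared, never stored.
  · refine ⟨fun x => toLex fun j => x.1 j, fun p q h => ?_, fun p q h => ⟨0, hc, ?_⟩⟩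
    · have : p = q := by
        ext j
        exact congrFun (toLex_inj.1 h) j
      rw [this, dist_self]
    · rw [dist_le_zero.1 h]
  have hd' : (0 : ℝ) < d := by exact_mod_cast hd
  -- Cells have side `ε / d`. At distance at most `ε` the indices differ by at most `d` in each
  -- coordinate, so the offsets, shifted by `d`, are words of length `d` over `2 * d + 1` digits.
  let cell : EuclideanSpace ℝ (Fin d) → Fin d → ℤ := fun p j => ⌊d * p j / ε⌋
  refine ⟨fun x => if h : x.2 < (2 * d + 1) ^ d then
      toLex fun j => (cell x.1 j : ℝ) + (finFunctionFinEquiv.symm ⟨x.2, h⟩ j : ℕ) - d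
    else toLex fun j => (cell x.1 j : ℝ), fun p q h => ?_, fun p q h => ?_⟩
  · simp only [lt_irrefl, dif_neg, not_false_eq_true, toLex_inj] at h
    refine dist_le_of_forall_abs_sub_le hd hε.le p q fun j => ?_
    have h1 : cell p j = cell q j := by exact_mod_cast congrFun h j
    have h2 := (Int.abs_sub_lt_one_of_floor_eq_floor h1).le
    have h3 : d * p j / ε - d * q j / ε = (p j - q j) * (d / ε) := by ring
    rw [h3, abs_mul, abs_of_pos (div_pos hd' hε)] at h2
    rw [le_div_iff₀ hd']
    rwa [mul_div_assoc', div_le_one hε] at h2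
  · have h1 : ∀ j, |cell p j - cell q j| ≤ d := by
      intro j
      have h2 := (abs_sub_le_dist p q j).trans h
      have h3 : |d * p j / ε - d * q j / ε| ≤ d := by
        have h3 : d * p j / ε - d * q j / ε = (p j - q j) * (d / ε) := by ring
        rw [h3, abs_mul, abs_of_pos (div_pos hd' hε), mul_div_assoc', div_le_iff₀ hε, mul_comm]
        exact mul_le_mul_of_nonneg_left h2 hd'.le
      rw [abs_le] at h3 ⊢
      have e1 : cell p j ≤ cell q j + d := by
        rw [← Int.floor_add_natCast]
        exact Int.floor_le_floor (by linarith)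
      have e2 : cell q j ≤ cell p j + d := by
        rw [← Int.floor_add_natCast]
        exact Int.floor_le_floor (by linarith)
      constructor <;> linarith
    let o : Fin d → Fin (2 * d + 1) := fun j =>
      ⟨(cell p j - cell q j + d).toNat, by have := abs_le.1 (h1 j); omega⟩
    refine ⟨finFunctionFinEquiv o, (finFunctionFinEquiv o).2, ?_⟩
    dsimp only
    rw [dif_pos (finFunctionFinEquiv o).2, dif_neg (lt_irrefl _)]
    congr 1
    funext j
    have e : ((o j : ℕ) : ℤ) = cell p j - cell q j + d := by
      have := abs_le.1 (h1 j)
      simp only [o]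
      omega
    have e' : ((o j : ℕ) : ℝ) = cell p j - cell q j + d := by exact_mod_cast e
    simp only [Fin.eta, Equiv.symm_apply_apply, e']
    ring

end Grid

/-! ### Choice of parameters and resource limits. -/

theorem sum_cnt_eq_card_filter {E : Type*} {m : ℕ} (P : Finset E) (I : Fin m → List E)
    (h : ∑ i, (I i : Multiset E) = P.val) (p : E → Prop) [DecidablePred p] :
    ∑ i, cnt p (I i) = (P.filter p).card := by
  rw [Finset.card_def, Finset.filter_val, ← Multiset.countP_eq_card_filter, ← h,
    ← Multiset.coe_countPAddMonoidHom, map_sum]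
  refine Finset.sum_congr rfl fun i _ => ?_
  rw [Multiset.coe_countPAddMonoidHom, Multiset.coe_countP, cnt]
  exact List.countP_congr fun x _ => by simp

/-- The word-level version of a protocol. -/
theorem exists_algorithm_of_protocol {d m : ℕ} (hd : 1 ≤ d) {κ : Type*} [LinearOrder κ]
    (Q : Protocol (EuclideanSpace ℝ (Fin d)) κ) :
    ∃ A : Algorithm m, A.rounds = 13 ∧ ∀ I : Fin m → List (EuclideanSpace ℝ (Fin d)),
      (A.memory (initialMemory I) 13 = fun i => (Q.out I i).flatMap encodeLabelled) ∧
      (∀ t < 13, A.memory (initialMemory I) t =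
        history initialMemory (fun I t i j => (Q.msg I t i j).flatMap encodeItem) I t) ∧
      ∀ t < 13, A.message (initialMemory I) t =
        fun i j => (Q.msg I t i j).flatMap encodeItem := by
  have hp := flatMap_injective_of_length encodePoint d hd length_encodePoint encodePoint_injective
  have hi := flatMap_injective_of_length encodeItem (d + 1) d.succ_pos length_encodeItem
    encodeItem_injective
  have hinp : ∀ (I : Fin m → List (EuclideanSpace ℝ (Fin d))) i q x, q ∈ I i →
      Word.coord x ∈ encodePoint q → Word.coord x ∈ initialMemory I i := fun I i q x hq hx =>
    List.mem_flatMap.2 ⟨q, hq, hx⟩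
  refine exists_algorithm_of_local 13 (by norm_num) initialMemory
    (fun I t i j => (Q.msg I t i j).flatMap encodeItem)
    (fun I i => (Q.out I i).flatMap encodeLabelled) ?_ ?_ ?_ ?_
  · intro I I' t i h hr j
    rw [Q.msg_congr t i (hp h) (fun s hs j => hi (hr s hs j)) j]
  · intro I I' i h hr
    rw [Q.out_congr i (hp h) (fun s hs j => hi (hr s hs j))]
  · intro I t i j x hx
    obtain ⟨q, hq, hqx⟩ := coord_mem_flatMap_encodeItem.1 hx
    rcases Protocol.fst_mem_of_mem_msg t hq with h | ⟨s, hs, k, y, hy, hyq⟩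
    · exact Or.inl (hinp _ _ _ _ h hqx)
    · exact Or.inr ⟨s, hs, k, coord_mem_flatMap_encodeItem.2 ⟨y, hy, hyq ▸ hqx⟩⟩
  · intro I i x hx
    obtain ⟨q, hq, hqx⟩ := List.mem_flatMap.1 hx
    obtain ⟨p, hpI, rfl⟩ := List.mem_map.1 hq
    refine Or.inl (hinp _ _ _ _ hpI ?_)
    simpa [encodeLabelled] using hqx

/-- Since `1 - α ≤ α`, a machine can afford one word for every other machine; broadcasts, length
markers and cells requested by all machines depend on this. -/
theorem machineCount_le {n : ℕ} (hn : 1 ≤ n) {α : ℝ} (hα : 1 / 2 < α) :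
    machineCount n α ≤ ⌈(n : ℝ) ^ α⌉₊ :=
  Nat.ceil_le_ceil (Real.rpow_le_rpow_of_exponent_le (by exact_mod_cast hn) (by linarith))

theorem machineCount_pos {n : ℕ} (hn : 1 ≤ n) {α : ℝ} : 0 < machineCount n α :=
  Nat.ceil_pos.2 (Real.rpow_pos_of_pos (by exact_mod_cast hn) _)

theorem ceil_div_machineCount_le {n : ℕ} (hn : 1 ≤ n) {α : ℝ} :
    ⌈(n : ℝ) / machineCount n α⌉₊ ≤ ⌈(n : ℝ) ^ α⌉₊ := by
  have hn' : (0 : ℝ) < n := by exact_mod_cast hn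
  refine Nat.ceil_le_ceil ?_
  rw [div_le_iff₀ (by exact_mod_cast machineCount_pos hn)]
  calc (n : ℝ) = (n : ℝ) ^ α * (n : ℝ) ^ (1 - α) := by
        rw [← Real.rpow_add hn', add_sub_cancel, Real.rpow_one]
    _ ≤ _ := mul_le_mul_of_nonneg_left (Nat.le_ceil _) (Real.rpow_nonneg hn'.le _)

theorem ceil_rpow_le_two_mul {n : ℕ} (hn : 1 ≤ n) {α : ℝ} (hα : 0 ≤ α) :
    (⌈(n : ℝ) ^ α⌉₊ : ℝ) ≤ 2 * (n : ℝ) ^ α := by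
  have h1 := Real.one_le_rpow (x := (n : ℝ)) (by exact_mod_cast hn) hα
  have h2 := Nat.ceil_lt_add_one (zero_le_one.trans h1)
  linarith

theorem ceil_rpow_le_self {n : ℕ} (hn : 1 ≤ n) {α : ℝ} (hα : α ≤ 1) : ⌈(n : ℝ) ^ α⌉₊ ≤ n := by
  refine Nat.ceil_le.2 ?_
  have := Real.rpow_le_rpow_of_exponent_le (x := (n : ℝ)) (by exact_mod_cast hn) hα
  rwa [Real.rpow_one] at this

/-- The records that a machine sends or receives in a round number at most this multiple of
`⌈n ^ α⌉`. -/
def recordBound (d minPts : ℕ) : ℕ := 33 * (minPts + 1) * (2 * d + 1) ^ d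

/-- The words that a machine stores, sends or receives number at most this multiple of
`⌈n ^ α⌉`. -/
def wordBound (d minPts : ℕ) : ℕ := 13 * (recordBound d minPts * (d + 1) + 1) + d + 1

/-- The numbers that are stored or sent are at most this multiple of `⌈n ^ α⌉ ^ 2`. -/
def numBound (d minPts : ℕ) : ℕ :=
  wordBound d minPts + 2 * (2 * d + 1) ^ d + 33 * minPts * ((2 * d + 1) ^ d) ^ 2

theorem exists_core_labelling (d minPts n : ℕ) (α ε : ℝ) (hd : 1 ≤ d) (hα : 1 / 2 < α)
    (hα1 : α < 1) (hε : 0 ≤ ε) (hn : 1 ≤ n) :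
    ∃ A : Algorithm (machineCount n α), A.rounds = 13 ∧
      ∀ P : Finset (EuclideanSpace ℝ (Fin d)), P.card = n →
        ∀ I : Fin (machineCount n α) → List (EuclideanSpace ℝ (Fin d)), IsEvenDistribution P I →
          A.RespectsLimits (initialMemory I) (2 * wordBound d minPts * (n : ℝ) ^ α)
            ((n + 1) ^ (numBound d minPts + 2)) ∧
          IsCoreLabelling P ε minPts (A.memory (initialMemory I) A.rounds) := by
  classical
  obtain ⟨key, hkey1, hkey2⟩ := exists_grid_key hd hε
  set m := machineCount n α with hm
  set ℓ := ⌈(n : ℝ) ^ α⌉₊ with hℓ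
  set c := (2 * d + 1) ^ d with hc
  have hc0 : 0 < c := by positivity
  have hmℓ : m ≤ ℓ := machineCount_le hn hα
  have hm0 : 0 < m := machineCount_pos hn
  have hℓ0 : 0 < ℓ := hm0.trans_le hmℓ
  let Q : Protocol (EuclideanSpace ℝ (Fin d)) (Lex (Fin d → ℝ)) :=
    { key := key
      c := c
      minPts := minPts
      -- The integer square root gives `g * g ≤ m ≤ g * g + 2 * g`, as `Fits` demands.
      g := m.sqrt
      L := ℓ * c
      near := fun p q => dist p q ≤ ε }
  have hQ : Q.Fits m :=
    { g_pos := Nat.sqrt_pos.2 hm0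
      sq_le := Nat.sqrt_le m
      le_mul := (Nat.sqrt_le_add m).trans (le_of_eq (by ring))
      m_le := hmℓ.trans (Nat.le_mul_of_pos_right _ hc0)
      self := fun p => hkey2 p p (by rwa [dist_self]) }
  obtain ⟨A, hA, hA'⟩ := exists_algorithm_of_protocol (m := m) hd Q
  refine ⟨A, hA, fun P hP I hI => ?_⟩
  obtain ⟨hmem, hhist, hmsg⟩ := hA' I
  have hIℓ : ∀ i, (I i).length ≤ ℓ := fun i => by
    have := hI.2 i
    rw [hP] at this
    exact this.trans (ceil_div_machineCount_le hn)
  have hIL : ∀ i, (I i).length ≤ Q.L := fun i => (hIℓ i).trans (Nat.le_mul_of_pos_right _ hc0)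
  have hitems : ∀ i, (Q.items (I i)).length ≤ Q.L := fun i =>
    (Protocol.length_items_le _).trans (Nat.mul_le_mul_right _ (hIℓ i))
  have hrec : ∀ t j, ∑ i, ((Q.msg I t i j).flatMap encodeItem).length ≤
      recordBound d minPts * (d + 1) * ℓ := by
    intro t j
    simp only [length_flatMap_encodeItem]
    rw [← Finset.sum_mul]
    refine (Nat.mul_le_mul_right _ (Protocol.length_recv_msg_le hQ hitems t j)).trans
      (le_of_eq ?_)
    show 33 * (minPts + 1) * (ℓ * c) * (d + 1) = 33 * (minPts + 1) * c * (d + 1) * ℓ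
    ring
  have hsent : ∀ t i, ∑ j, ((Q.msg I t i j).flatMap encodeItem).length ≤
      recordBound d minPts * (d + 1) * ℓ := by
    intro t i
    simp only [length_flatMap_encodeItem]
    rw [← Finset.sum_mul]
    refine (Nat.mul_le_mul_right _ (Protocol.sum_length_msg_le hQ hitems hIL t i)).trans
      (le_of_eq ?_)
    show 33 * (minPts + 1) * (ℓ * c) * (d + 1) = 33 * (minPts + 1) * c * (d + 1) * ℓ
    ring
  have hRW : recordBound d minPts * (d + 1) * ℓ ≤ wordBound d minPts * ℓ :=
    Nat.mul_le_mul_right _ (by rw [wordBound]; omega)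
  have hreal : ∀ k : ℕ, k ≤ wordBound d minPts * ℓ →
      (k : ℝ) ≤ 2 * wordBound d minPts * (n : ℝ) ^ α := by
    intro k hk
    have h1 : (k : ℝ) ≤ wordBound d minPts * ℓ := by exact_mod_cast hk
    have h2 := ceil_rpow_le_two_mul hn (α := α) (by linarith)
    have h3 : (wordBound d minPts : ℝ) * ℓ ≤ wordBound d minPts * (2 * (n : ℝ) ^ α) :=
      mul_le_mul_of_nonneg_left h2 (Nat.cast_nonneg _)
    linarith
  have hW : ∀ k, k ≤ numBound d minPts * ℓ ^ 2 → k ≤ (n + 1) ^ (numBound d minPts + 2) := by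
    intro k hk
    refine hk.trans ?_
    -- The constant factor is absorbed through `N ≤ 2 ^ N ≤ (n + 1) ^ N`, valid as `n ≥ 1`; the
    -- factor `ℓ ^ 2` costs the exponent `2`.
    rw [pow_add]
    refine Nat.mul_le_mul ?_ ?_
    · exact Nat.lt_two_pow_self.le.trans (Nat.pow_le_pow_left (by omega) _)
    · exact Nat.pow_le_pow_left ((ceil_rpow_le_self hn hα1.le).trans (by omega)) 2
  have hℓ2 : ℓ ≤ ℓ ^ 2 := Nat.le_self_pow two_ne_zero ℓ
  have hword : ∀ k, k ≤ wordBound d minPts * ℓ → k ≤ (n + 1) ^ (numBound d minPts + 2) := by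
    intro k hk
    refine hW k (hk.trans (Nat.mul_le_mul ?_ hℓ2))
    rw [numBound]
    omega
  have hone : 1 ≤ (n + 1) ^ (numBound d minPts + 2) := Nat.one_le_pow _ _ (by omega)
  have hnum : ∀ t i j k, Word.num k ∈ (Q.msg I t i j).flatMap encodeItem →
      k ≤ (n + 1) ^ (numBound d minPts + 2) := by
    intro t i j k hk
    obtain ⟨q, hq, rfl⟩ := num_mem_flatMap_encodeItem.1 hk
    refine hW _ ((Protocol.snd_le_of_mem_msg hQ hitems hIL t hq).trans ?_)
    show c + ℓ * c + minPts * (33 * (ℓ * c)) * (ℓ * c) ≤ _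
    have e1 : c ≤ c * ℓ ^ 2 := Nat.le_mul_of_pos_right _ (by positivity)
    have e2 : ℓ * c ≤ c * ℓ ^ 2 := by rw [mul_comm]; exact Nat.mul_le_mul_left _ hℓ2
    have e3 : numBound d minPts * ℓ ^ 2 = wordBound d minPts * ℓ ^ 2 + c * ℓ ^ 2 + c * ℓ ^ 2 +
        minPts * (33 * (ℓ * c)) * (ℓ * c) := by
      rw [numBound]; ring
    rw [e3]
    omega
  have hnear : ∀ p, ∑ i, cnt (fun q => Q.near p q) (I i) =
      ((P : Set (EuclideanSpace ℝ (Fin d))) ∩ Metric.closedBall p ε).ncard := by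
    intro p
    rw [sum_cnt_eq_card_filter P I hI.1, ← Set.ncard_coe_finset]
    congr 1
    ext q
    simp [Q, dist_comm]
  have hnd : ∀ p, ∑ i, cnt (fun q => q = p) (I i) ≤ 1 := by
    intro p
    rw [sum_cnt_eq_card_filter P I hI.1, Finset.card_le_one]
    intro a ha b hb
    rw [(Finset.mem_filter.1 ha).2, (Finset.mem_filter.1 hb).2]
  have hout : ∀ i, (Q.out I i).map Prod.fst = I i := fun i => by
    simp [Protocol.out, Function.comp_def]
  refine ⟨⟨fun t ht i => hreal _ ?_, fun t ht i => hreal _ ?_, fun t ht j => hreal _ ?_,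
    fun t ht i k hk => ?_, fun t ht i j k hk => ?_⟩, ?_⟩
  · rw [hA] at ht
    rcases ht.lt_or_eq with ht | rfl
    · rw [hhist t ht, length_history]
      -- Each past round occupies the words received and one length marker per sender.
      have h1 : ∑ s ∈ Finset.range t, ((∑ j, ((Q.msg I s j i).flatMap encodeItem).length) + m) ≤
          13 * (recordBound d minPts * (d + 1) * ℓ + ℓ) := by
        refine (Finset.sum_le_card_nsmul _ _ (recordBound d minPts * (d + 1) * ℓ + ℓ)
          fun s _ => Nat.add_le_add (hrec s i) hmℓ).trans ?_
        rw [Finset.card_range, smul_eq_mul]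
        exact Nat.mul_le_mul_right _ ht.le
      have h2 : (initialMemory I i).length ≤ ℓ * d := by
        rw [initialMemory, length_flatMap_encodePoint]
        exact Nat.mul_le_mul_right _ (hIℓ i)
      refine (Nat.add_le_add h2 h1).trans ?_
      rw [wordBound]
      nlinarith
    · rw [hmem, length_flatMap_encodeLabelled, ← List.length_map Prod.fst, hout]
      refine (Nat.mul_le_mul_right _ (hIℓ i)).trans ?_
      rw [mul_comm]
      refine Nat.mul_le_mul_right _ ?_
      rw [wordBound]
      omega
  · rw [hmsg t (hA ▸ ht)]
    exact (hsent t i).trans hRW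
  · rw [hmsg t (hA ▸ ht)]
    exact (hrec t j).trans hRW
  · rw [hA] at ht
    rcases ht.lt_or_eq with ht | rfl
    · rw [hhist t ht] at hk
      rcases num_mem_history _ _ _ _ _ _ hk with h | ⟨s, -, j, h | rfl⟩
      · exact absurd h num_notMem_flatMap_encodePoint
      · exact hnum _ _ _ _ h
      · refine hword _ (le_trans ?_ ((hrec s i).trans hRW))
        exact Finset.single_le_sum
          (f := fun j => ((Q.msg I s j i).flatMap encodeItem).length)
          (fun _ _ => Nat.zero_le _) (Finset.mem_univ j)
    · rw [hmem] at hk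
      refine le_trans ?_ hone
      obtain ⟨q, -, hq⟩ := List.mem_flatMap.1 hk
      rw [encodeLabelled] at hq
      rcases List.mem_append.1 hq with hq | hq
      · simp [encodePoint] at hq
      · simp only [List.mem_singleton, Word.num.injEq] at hq
        rw [hq]
        split_ifs <;> simp
  · rw [hmsg t (hA ▸ ht)] at hk
    exact hnum _ _ _ _ hk
  · rw [hA, hmem]
    refine ⟨Q.out I, fun _ => rfl, ?_, fun i q hq => ?_⟩
    · simp only [hout]
      exact hI.1
    · have hqP : q.1 ∈ P := by
        have h1 : q.1 ∈ I i := hout i ▸ List.mem_map_of_mem hq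
        rw [← Finset.mem_val, ← hI.1, Multiset.mem_sum]
        exact ⟨i, Finset.mem_univ i, h1⟩
      have h := Protocol.snd_eq_true_iff_of_mem_out hQ hitems hkey1 hkey2 hnd hq
      rw [hnear] at h
      rw [h, IsCore]
      exact ⟨fun h => ⟨hqP, h⟩, And.right⟩

end DBSCAN

theorem mainTheorem11 :
    ∃ C : ℝ, 0 < C ∧
      ∀ (d minPts : ℕ) (α : ℝ), 2 ≤ d → 1 ≤ minPts → 1 / 2 < α → α < 1 →
        ∃ (K : ℝ) (c : ℕ) (A : (n : ℕ) → (ε : ℝ) → MPC.Algorithm (MPC.machineCount n α)),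
          0 < K ∧
          ∀ (n : ℕ) (ε : ℝ), 0 ≤ ε →
            ((A n ε).rounds : ℝ) ≤ C * (1 / α) ∧
            ∀ (P : Finset (EuclideanSpace ℝ (Fin d))), P.card = n →
              ∀ (input : Fin (MPC.machineCount n α) → List (EuclideanSpace ℝ (Fin d))),
                DBSCAN.IsEvenDistribution P input →
                (A n ε).RespectsLimits (DBSCAN.initialMemory input)
                  (K * (n : ℝ) ^ α) ((n + 1) ^ c) ∧
                DBSCAN.IsCoreLabelling P ε minPts
                  ((A n ε).memory (DBSCAN.initialMemory input) (A n ε).rounds) := by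
  -- Thirteen rounds are at most `13 / α` because `α < 1`.
  refine ⟨13, by norm_num, fun d minPts α hd _ hα hα1 => ?_⟩
  have hα0 : 0 < α := by linarith
  have idle : ∀ m, ∃ A : MPC.Algorithm m, A.rounds = 0 := fun m =>
    ⟨⟨0, fun _ _ _ _ => [], fun _ _ _ _ => [], by simp, by simp⟩, rfl⟩
  have h : ∀ (n : ℕ) (ε : ℝ), ∃ A : MPC.Algorithm (MPC.machineCount n α), 0 ≤ ε →
      (A.rounds : ℝ) ≤ 13 * (1 / α) ∧
      ∀ (P : Finset (EuclideanSpace ℝ (Fin d))), P.card = n →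
        ∀ (input : Fin (MPC.machineCount n α) → List (EuclideanSpace ℝ (Fin d))),
          DBSCAN.IsEvenDistribution P input →
          A.RespectsLimits (DBSCAN.initialMemory input)
            (2 * DBSCAN.wordBound d minPts * (n : ℝ) ^ α)
            ((n + 1) ^ (DBSCAN.numBound d minPts + 2)) ∧
          DBSCAN.IsCoreLabelling P ε minPts
            (A.memory (DBSCAN.initialMemory input) A.rounds) := by
    intro n ε
    by_cases hε : 0 ≤ ε
    · rcases Nat.eq_zero_or_pos n with rfl | hn
      · obtain ⟨A, hA⟩ := idle (MPC.machineCount 0 α)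
        -- For `n = 0` there are no machines, and the idle algorithm is correct for the empty set.
        have h0 : MPC.machineCount 0 α = 0 := by
          rw [MPC.machineCount, Nat.cast_zero, Real.zero_rpow (by linarith), Nat.ceil_zero]
        have : IsEmpty (Fin (MPC.machineCount 0 α)) := by rw [h0]; exact Fin.isEmpty
        refine ⟨A, fun _ => ⟨by rw [hA, Nat.cast_zero]; positivity, fun P hP input hin => ⟨⟨?_, ?_, ?_, ?_, ?_⟩,
          fun i => isEmptyElim i, fun i => isEmptyElim i, ?_, fun i => isEmptyElim i⟩⟩⟩
        · exact fun _ _ i => isEmptyElim i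
        · exact fun _ _ i => isEmptyElim i
        · exact fun _ _ i => isEmptyElim i
        · exact fun _ _ i => isEmptyElim i
        · exact fun _ _ i => isEmptyElim i
        · rw [Finset.card_eq_zero.1 hP]
          simp
      · obtain ⟨A, hA, hA'⟩ := DBSCAN.exists_core_labelling d minPts n α ε (by omega) hα hα1 hε hn
        refine ⟨A, fun _ => ⟨?_, hA'⟩⟩
        rw [hA]
        have : 1 ≤ 1 / α := by rw [le_div_iff₀ hα0]; linarith
        push_cast
        linarith
    · obtain ⟨A, -⟩ := idle (MPC.machineCount n α)
      exact ⟨A, fun h => absurd h hε⟩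
  choose A hA using h
  refine ⟨2 * DBSCAN.wordBound d minPts, DBSCAN.numBound d minPts + 2, A, ?_, hA⟩
  have : 0 < DBSCAN.wordBound d minPts := by rw [DBSCAN.wordBound]; omega
  positivity
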